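/- **Definitions.** Fix an integer $n\ge 1$. Let $L_n$ be the language with one $n$-ary relation symbol $R$. For an $L_n$-structure $M$ and a finite $X\subseteq M$ put $\delta(X)=|X|-|R^M\cap X^n|$. Let $\bar{\mathcal C}_n$ be the class of $L_n$-structures $M$ with $\delta(X)\ge 0$ for all finite $X\subseteq M$, and $\mathcal C_n$ the class of finite members of $\bar{\mathcal C}_n$. For finite $A\subseteq M\in\bar{\mathcal C}_n$ write $A\le_n M$ if $\delta(A)\le\delta(B)$ for every finite $B$ with $A\subseteq B\subseteq M$. A generic structure for $(\mathcal C_n,\le_n)$ is a countable $M\in\bar{\mathcal C}_n$ such that whenever $A\le_n M$ is finite and $A\le_n B\in\mathcal C_n$, there is an embedding $g:B\to M$ that is the identity on $A$ and satisfies $g(B)\le_n M$. For $M\in\bar{\mathcal C}_n$ and finite $A\subseteq M$ let $d_M(A)=\min\{\delta(B): A\subseteq B\subseteq M,\ B\text{ finite}\}$. Let $PG(M)$ be the pregeometry on the set $M$ in which the closure of a finite $A$ is $\{c\in M: d_M(A\cup\{c\})=d_M(A)\}$, and the closure of an arbitrary set is the union of the closures of its finite subsets. Pregeometries are regarded as structures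 in the language $LPI$ with one $k$-ary relation symbol $I_k$ for every $k\ge1$, where $I_k$ is interpreted as the set of independent $k$-tuples; embeddings and isomorphisms are those of $LPI$-structures. For finite pregeometries $A\subseteq B$ ($A$ a substructure of $B$) write $A\unlhd_n B$ if there are $\widetilde A,\widetilde B\in\mathcal C_n$ on the underlying sets of $A,B$ with $PG(\widetilde A)=A$, $PG(\widetilde B)=B$, $\widetilde A$ a substructure of $\widetilde B$, and $\widetilde A\le_n\widetilde B$. Let $P_n$ be the class of finite pregeometries $A$ with $\emptyset\unlhd_n A$. Let $L$ be a countable relational language whose symbols all have positive arity. Call $(\mathcal C,\le)$ *admissible* if $\mathcal C$ is a non-empty class of finite $L$-structures, closed under isomorphism (not necessarily under substructures), with countably many isomorphism types, and $\le$ is an isomorphism-invariant relation between members of $\mathcal C$ such that $A\le B$ implies that $A$ is a substructure of $B$. A *generic model* for $(\mathcal C,\le)$ is a countable $L$-structure $M$ that is the union of a chain $M_0\le M_1\le M_2\le\cdots$ of members of $\mathcal C$ such that whenever $A\le M_i$ and $A\le B\in\mathcal C$, there are $j$ and an embedding $f:B\to M_j$ that is the identity on $A$ and satisfies $f(B)\le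 M_j$. **Theorem.** 1. Let $(\mathcal C,\le)$ be admissible (over any such $L$), and suppose that $\emptyset\le A$ for all $A\in\mathcal C$, that $\le$ is transitive, and that $(\mathcal C,\le)$ has amalgamation: whenever $A_0,A_1,A_2\in\mathcal C$ and $g_i:A_0\to A_i$ are embeddings with $g_i(A_0)\le A_i$ ($i=1,2$), there are $P\in\mathcal C$ and embeddings $f_i:A_i\to P$ with $f_i(A_i)\le P$ and $f_1g_1=f_2g_2$. Then $(\mathcal C,\le)$ has a generic model, and any two generic models are isomorphic. 2. For every $n\ge1$, $(P_n,\unlhd_n)$ is admissible, $\emptyset\unlhd_n A$ for all $A\in P_n$, $\unlhd_n$ is transitive, and $(P_n,\unlhd_n)$ has amalgamation. 3. For every $n\ge1$, there is a generic model $\mathcal P_n$ for $(P_n,\unlhd_n)$, unique up to isomorphism. There is a generic structure $\mathcal M_n$ for $(\mathcal C_n,\le_n)$, unique up to isomorphism. Moreover $$\mathcal P_n\cong PG(\mathcal M_n).$$ -/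

import Mathlib

open FirstOrder CategoryTheory

universe u v w

namespace HrushovskiGeometry

/-! ### Pregeometries and the language of pregeometries -/

/-- A pregeometry on `M`: a finitary closure operator with the exchange property. -/
structure Pregeometry (M : Type w) where
  cl : Set M → Set M
  subset_cl : ∀ X, X ⊆ cl X
  mono : ∀ X Y, X ⊆ Y → cl X ⊆ cl Y
  idem : ∀ X, cl (cl X) = cl X
  finitary : ∀ X, ∀ c ∈ cl X, ∃ Y ⊆ X, Y.Finite ∧ c ∈ cl Y
  exchange : ∀ X a b, b ∈ cl (insert a X) → b ∉ cl X → a ∈ cl (insert b X)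

/-- The relation symbols of `LPI`: one symbol `I k` of arity `k + 1` for each `k : ℕ`. -/
inductive LPIRel : ℕ → Type
  | I (k : ℕ) : LPIRel (k + 1)

/-- The relational language `LPI` of pregeometries: one `k`-ary relation symbol for each `k ≥ 1`. -/
def LPI : FirstOrder.Language.{0, 0} := ⟨fun _ => Empty, LPIRel⟩

/-- A tuple is independent if no entry is in the closure of the set of the other entries
(in particular the entries are pairwise distinct). -/
def Pregeometry.Indep {M : Type w} (P : Pregeometry M) {k : ℕ} (a : Fin k → M) : Prop :=
  ∀ i, a i ∉ P.cl (a '' {j | j ≠ i})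

/-- A pregeometry as an `LPI`-structure: the symbols are interpreted as the independent tuples. -/
@[reducible]
def Pregeometry.lpi {M : Type w} (P : Pregeometry M) : LPI.Structure M where
  funMap := fun {_} f => Empty.elim f
  RelMap := fun {_} _ a => P.Indep a

/-! ### The predimension -/

/-- The single relation symbol, of arity `n`. -/
inductive LnRel (n : ℕ) : ℕ → Type
  | R : LnRel n n

/-- The language `L_n` with a single relation symbol, which is `n`-ary. -/
def Ln (n : ℕ) : FirstOrder.Language.{0, 0} := ⟨fun _ => Empty, LnRel n⟩

/-- The relation symbol of `L_n`. -/
def Rn (n : ℕ) : (Ln n).Relations n := LnRel.R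

section Predimension

variable (n : ℕ) {M : Type w} [(Ln n).Structure M]

/-- The `n`-tuples of elements of `X` which satisfy the relation. -/
def relSet (X : Set M) : Set (Fin n → M) :=
  {t | FirstOrder.Language.Structure.RelMap (Rn n) t ∧ ∀ i, t i ∈ X}

/-- The predimension `δ(X) = |X| - |R^X|` (used only for finite `X`). -/
noncomputable def delta (X : Set M) : ℤ := (X.ncard : ℤ) - ((relSet n X).ncard : ℤ)

variable (M) in
/-- `M` is in the class of structures all of whose finite substructures have predimension `≥ 0`
(hereditarily, as all finite subsets are considered). -/
def InCbar : Prop := ∀ X : Set M, X.Finite → 0 ≤ delta n X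

/-- For a finite subset `A` of `M`: `A` is self-sufficient in `M`. -/
def SelfSufficient (A : Set M) : Prop :=
  A.Finite ∧ ∀ B : Set M, B.Finite → A ⊆ B → delta n A ≤ delta n B

/-- The dimension of a finite set: the minimum of `δ` over its finite supersets. -/
noncomputable def dim (A : Set M) : ℤ :=
  sInf {z | ∃ B : Set M, B.Finite ∧ A ⊆ B ∧ delta n B = z}

/-- The `d`-closure of a set `X`: the union over finite `A ⊆ X` of `{c | d(A ∪ {c}) = d(A)}`. -/
def dcl (X : Set M) : Set M :=
  {c | ∃ A ⊆ X, A.Finite ∧ dim n (insert c A) = dim n A}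

/-! ### The `d`-closure is a pregeometry -/

variable {n}

theorem relSet_finite {X : Set M} (hX : X.Finite) : (relSet n X).Finite :=
  (Set.Finite.pi' (fun _ : Fin n => hX)).subset fun _ ht => ht.2

theorem delta_submodular {X Y : Set M} (hX : X.Finite) (hY : Y.Finite) :
    delta n (X ∪ Y) + delta n (X ∩ Y) ≤ delta n X + delta n Y := by
  have h1 := Set.ncard_union_add_ncard_inter X Y hX hY
  have h2 := Set.ncard_union_add_ncard_inter (relSet n X) (relSet n Y)
    (relSet_finite hX) (relSet_finite hY)
  have h3 : relSet n X ∩ relSet n Y = relSet n (X ∩ Y) := by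
    ext t
    simp only [relSet, Set.mem_inter_iff, Set.mem_ofPred_eq]
    constructor
    · rintro ⟨⟨h, a⟩, -, b⟩
      exact ⟨h, fun i => ⟨a i, b i⟩⟩
    · rintro ⟨h, a⟩
      exact ⟨⟨h, fun i => (a i).1⟩, h, fun i => (a i).2⟩
  have h4 : (relSet n X ∪ relSet n Y).ncard ≤ (relSet n (X ∪ Y)).ncard := by
    apply Set.ncard_le_ncard _ (relSet_finite (hX.union hY))
    rintro t (⟨h, a⟩ | ⟨h, a⟩)
    · exact ⟨h, fun i => Or.inl (a i)⟩
    · exact ⟨h, fun i => Or.inr (a i)⟩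
  rw [h3] at h2
  unfold delta
  omega

theorem dim_bdd (h : InCbar n M) (A : Set M) :
    BddBelow {z | ∃ B : Set M, B.Finite ∧ A ⊆ B ∧ delta n B = z} :=
  ⟨0, by rintro _ ⟨B, hB, -, rfl⟩; exact h B hB⟩

theorem dim_le (h : InCbar n M) {A B : Set M} (hB : B.Finite) (hAB : A ⊆ B) :
    dim n A ≤ delta n B :=
  csInf_le (dim_bdd h A) ⟨B, hB, hAB, rfl⟩

theorem dim_attained (h : InCbar n M) {A : Set M} (hA : A.Finite) :
    ∃ B : Set M, B.Finite ∧ A ⊆ B ∧ delta n B = dim n A :=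
  Int.csInf_mem (s := {z | ∃ B : Set M, B.Finite ∧ A ⊆ B ∧ delta n B = z})
    ⟨delta n A, A, hA, subset_rfl, rfl⟩ (dim_bdd h A)

theorem dim_mono (h : InCbar n M) {A B : Set M} (hB : B.Finite) (hAB : A ⊆ B) :
    dim n A ≤ dim n B := by
  obtain ⟨C, hC, hBC, e⟩ := dim_attained h hB
  exact e ▸ dim_le h hC (hAB.trans hBC)

theorem dim_submodular (h : InCbar n M) {A B C : Set M} (hA : A.Finite) (hB : B.Finite)
    (hCA : C ⊆ A) (hCB : C ⊆ B) : dim n (A ∪ B) + dim n C ≤ dim n A + dim n B := by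
  obtain ⟨A', hA', hAA, eA⟩ := dim_attained h hA
  obtain ⟨B', hB', hBB, eB⟩ := dim_attained h hB
  have h1 := delta_submodular (n := n) hA' hB'
  have h2 := dim_le h (hA'.union hB') (Set.union_subset_union hAA hBB)
  have h3 := dim_le h (hA'.inter_of_left B') (Set.subset_inter (hCA.trans hAA) (hCB.trans hBB))
  omega

theorem dim_insert_le (h : InCbar n M) {A : Set M} (hA : A.Finite) (c : M) :
    dim n (insert c A) ≤ dim n A + 1 := by
  obtain ⟨B, hB, hAB, e⟩ := dim_attained h hA
  have h1 := dim_le h (hB.insert c) (Set.insert_subset_insert hAB)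
  have h2 := Set.ncard_insert_le c B
  have h3 : (relSet n B).ncard ≤ (relSet n (insert c B)).ncard :=
    Set.ncard_le_ncard (fun t ht => ⟨ht.1, fun i => Or.inr (ht.2 i)⟩)
      (relSet_finite (hB.insert c))
  unfold delta at h1 e
  omega

theorem dim_insert_of_subset (h : InCbar n M) {A B : Set M} (hB : B.Finite) (hAB : A ⊆ B) {c : M}
    (hc : dim n (insert c A) = dim n A) : dim n (insert c B) = dim n B := by
  have h1 := dim_submodular h ((hB.subset hAB).insert c) hB (Set.subset_insert c A) hAB
  have h2 : insert c A ∪ B = insert c B := by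
    rw [Set.insert_union, Set.union_eq_self_of_subset_left hAB]
  have h3 := dim_mono h (hB.insert c) (Set.subset_insert c B)
  rw [h2] at h1
  omega

theorem dcl_finite_iff (h : InCbar n M) {A : Set M} (hA : A.Finite) {c : M} :
    c ∈ dcl n A ↔ dim n (insert c A) = dim n A :=
  ⟨fun ⟨_, hBA, _, e⟩ => dim_insert_of_subset h hA hBA e, fun e => ⟨A, subset_rfl, hA, e⟩⟩

theorem dcl_mono {X Y : Set M} (hXY : X ⊆ Y) : dcl n X ⊆ dcl n Y :=
  fun _ ⟨A, hA, h⟩ => ⟨A, hA.trans hXY, h⟩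

theorem subset_dcl (X : Set M) : X ⊆ dcl n X := fun c hc =>
  ⟨{c}, by simpa using hc, Set.finite_singleton c, by simp⟩

/-- Finitely many elements of `dcl X` are in the closure of one finite subset of `X`. -/
theorem exists_base (h : InCbar n M) {X A : Set M} (hA : A.Finite) (hAX : A ⊆ dcl n X) :
    ∃ Y ⊆ X, Y.Finite ∧ dim n (A ∪ Y) = dim n Y := by
  induction A, hA using Set.Finite.induction_on with
  | empty => exact ⟨∅, Set.empty_subset _, Set.finite_empty, by simp⟩
  | @insert a A _ hA ih =>
    obtain ⟨Y, hYX, hY, e⟩ := ih ((Set.subset_insert a A).trans hAX)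
    obtain ⟨Z, hZX, hZ, e'⟩ := hAX (Set.mem_insert a A)
    have hYZ := hY.union hZ
    refine ⟨Y ∪ Z, Set.union_subset hYX hZX, hYZ, ?_⟩
    have h1 : dim n (insert a (A ∪ (Y ∪ Z))) = dim n (A ∪ (Y ∪ Z)) :=
      dim_insert_of_subset h (hA.union hYZ)
        (Set.subset_union_right.trans Set.subset_union_right) e'
    have h2 := dim_submodular h (hA.union hY) hYZ Set.subset_union_right Set.subset_union_left
    have h3 : A ∪ Y ∪ (Y ∪ Z) = A ∪ (Y ∪ Z) := by
      rw [Set.union_assoc, ← Set.union_assoc Y Y Z, Set.union_self]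
    have h4 := dim_mono h (hA.union hYZ) (Set.subset_union_right (s := A) (t := Y ∪ Z))
    rw [h3] at h2
    rw [Set.insert_union]
    omega

theorem dcl_idem (h : InCbar n M) (X : Set M) : dcl n (dcl n X) = dcl n X := by
  refine Set.Subset.antisymm ?_ (subset_dcl _)
  rintro c ⟨A, hAX, hA, e⟩
  obtain ⟨Y, hYX, hY, e'⟩ := exists_base h hA hAX
  refine ⟨Y, hYX, hY, ?_⟩
  have h1 := dim_insert_of_subset h (hA.union hY) Set.subset_union_left e
  have h2 := dim_mono h ((hA.union hY).insert c)
    (Set.insert_subset_insert (a := c) (Set.subset_union_right (s := A) (t := Y)))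
  have h3 := dim_mono h (hY.insert c) (Set.subset_insert c Y)
  omega

theorem dcl_exchange (h : InCbar n M) (X : Set M) (a b : M) (hb : b ∈ dcl n (insert a X))
    (hbX : b ∉ dcl n X) : a ∈ dcl n (insert b X) := by
  obtain ⟨A, hA, hAf, e⟩ := hb
  set Y := A \ {a} with hYdef
  have hYX : Y ⊆ X := by
    rintro x ⟨hx, hxa⟩
    exact (hA hx).resolve_left hxa
  have hY : Y.Finite := hAf.subset Set.sdiff_subset
  have hAY : A ⊆ insert a Y := by
    intro x hx
    by_cases hxa : x = a
    · exact Or.inl hxa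
    · exact Or.inr ⟨hx, hxa⟩
  have h1 := dim_insert_of_subset h (hY.insert a) hAY e
  have h2 : dim n (insert b Y) ≠ dim n Y := fun e' => hbX ⟨Y, hYX, hY, e'⟩
  have h3 := dim_mono h (hY.insert b) (Set.subset_insert b Y)
  have h4 := dim_insert_le h hY a
  have h5 := dim_mono h ((hY.insert b).insert a) (Set.subset_insert a (insert b Y))
  refine ⟨insert b Y, Set.insert_subset_insert hYX, hY.insert b, ?_⟩
  rw [Set.insert_comm] at h1
  omega

end Predimension

/-- The pregeometry `PG(M)` given by the `d`-closure. -/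
def PG (n : ℕ) (M : Type w) [(Ln n).Structure M] (h : InCbar n M) : Pregeometry M where
  cl := dcl n
  subset_cl := subset_dcl
  mono := fun _ _ => dcl_mono
  idem := dcl_idem h
  finitary := fun _ _ ⟨A, hAX, hA, e⟩ => ⟨A, hAX, hA, A, subset_rfl, hA, e⟩
  exchange := dcl_exchange h

/-- `PG(M)` as an `LPI`-structure with underlying set `M`. -/
def PGStr (n : ℕ) (M : Type w) [(Ln n).Structure M] (h : InCbar n M) :
    Bundled.{w} LPI.Structure := ⟨M, (PG n M h).lpi⟩

/-! ### Classes of structures with distinguished substructures -/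

/-- A class of `L`-structures together with a relation `A ≤ B` for structures `B` and
substructures `A` of `B`. -/
structure StrongClass (L : FirstOrder.Language.{u, v}) where
  mem : Bundled.{w} L.Structure → Prop
  strong : ∀ B : Bundled.{w} L.Structure, L.Substructure B → Prop

namespace StrongClass

variable {L : FirstOrder.Language.{u, v}} (K : StrongClass.{u, v, w} L)

/-- For substructures `S`, `T` of a structure `M`: `S ⊆ T` and `S ≤ T`. -/
def StrongIn {M : Type w} [L.Structure M] (S T : L.Substructure M) : Prop :=
  S ≤ T ∧ K.strong ⟨T, inferInstance⟩ (S.comap T.subtype.toHom)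

/-- `f` is an embedding whose image is a distinguished substructure: `f(A) ≤ B`. -/
def IsStrongEmb {A : Type w} [L.Structure A] {B : Bundled.{w} L.Structure} (f : A ↪[L] B) : Prop :=
  K.strong B f.toHom.range

/-- The standing conditions: a non-empty, isomorphism-closed class of finite structures, with
countably many isomorphism types, and an isomorphism-invariant relation `≤` between members
of the class. -/
structure IsAdmissible : Prop where
  nonempty : ∃ A, K.mem A
  finite : ∀ A, K.mem A → Finite A
  countable : ∃ T : Set (Bundled.{w} L.Structure), T.Countable ∧
    ∀ A, K.mem A → ∃ B ∈ T, Nonempty (A ≃[L] B)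
  mem_iso : ∀ A B : Bundled.{w} L.Structure, Nonempty (A ≃[L] B) → K.mem A → K.mem B
  mem_of_strong : ∀ (B : Bundled.{w} L.Structure) (S : L.Substructure B),
    K.strong B S → K.mem ⟨S, inferInstance⟩ ∧ K.mem B
  strong_iso : ∀ (B B' : Bundled.{w} L.Structure) (e : B ≃[L] B') (S : L.Substructure B),
    K.strong B S → K.strong B' (S.map e.toHom)

/-- The empty substructure of each member is distinguished. -/
def EmptyStrong : Prop := ∀ A, K.mem A → K.strong A ⊥

/-- If `S ≤ T ≤ C` then `S ≤ C`. -/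
def IsTransitive : Prop :=
  ∀ (C : Bundled.{w} L.Structure) (S T : L.Substructure C),
    K.StrongIn S T → K.strong C T → K.strong C S

/-- The amalgamation property for embeddings with distinguished image. -/
def Amalgamation : Prop :=
  ∀ (A₀ A₁ A₂ : Bundled.{w} L.Structure) (g₁ : A₀ ↪[L] A₁) (g₂ : A₀ ↪[L] A₂),
    K.mem A₀ → K.mem A₁ → K.mem A₂ → K.IsStrongEmb g₁ → K.IsStrongEmb g₂ →
    ∃ (P : Bundled.{w} L.Structure) (f₁ : A₁ ↪[L] P) (f₂ : A₂ ↪[L] P),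
      K.mem P ∧ K.IsStrongEmb f₁ ∧ K.IsStrongEmb f₂ ∧ ∀ a, f₁ (g₁ a) = f₂ (g₂ a)

/-- `M` is a generic model of the class: it is countable and the union of a chain
`M₀ ≤ M₁ ≤ ⋯` of members of the class such that, whenever `A ≤ Mᵢ` and `A ≤ B` (via `g`) with `B`
in the class, there are `j` and an embedding `f` of `B` into `Mⱼ` over `A` with `f(B) ≤ Mⱼ`. -/
def IsGeneric (M : Bundled.{w} L.Structure) : Prop :=
  Countable M ∧ ∃ c : ℕ → L.Substructure M,
    (∀ i, K.mem ⟨c i, inferInstance⟩) ∧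
    (∀ i, K.StrongIn (c i) (c (i + 1))) ∧
    (∀ x : M, ∃ i, x ∈ c i) ∧
    ∀ (i : ℕ) (A : L.Substructure M), K.StrongIn A (c i) →
      ∀ (B : Bundled.{w} L.Structure) (g : A ↪[L] B), K.mem B → K.IsStrongEmb g →
        ∃ (j : ℕ) (f : B ↪[L] M), (∀ a : A, f (g a) = a) ∧ K.StrongIn f.toHom.range (c j)

end StrongClass

/-! ### The classes `C_n` and `P_n` -/

/-- The class `(C_n, ≤_n)`. -/
def classC (n : ℕ) : StrongClass.{0, 0, w} (Ln n) where
  mem A := Finite A ∧ InCbar n A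
  strong B A := (Finite B ∧ InCbar n B) ∧ SelfSufficient n (A : Set B)

/-- `M` is a generic structure for `(C_n, ≤_n)`: it is countable, all its finite substructures are
in `C_n`, and whenever `A ≤ M` is finite and `A ≤ B` (via `g`) with `B` in `C_n`, there is an
embedding `f` of `B` into `M` over `A` with `f(B) ≤ M`. -/
structure IsGenericC (n : ℕ) (M : Bundled.{w} (Ln n).Structure) : Prop where
  countable : Countable M
  inCbar : InCbar n M
  extension : ∀ A : (Ln n).Substructure M, SelfSufficient n (A : Set M) →
    ∀ (B : Bundled.{w} (Ln n).Structure) (g : A ↪[Ln n] B), (classC n).mem B →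
      (classC n).IsStrongEmb g →
      ∃ f : B ↪[Ln n] M, (∀ a : A, f (g a) = a) ∧
        SelfSufficient n (f.toHom.range : Set M)

/-- `A ⊴_n B` for a finite pregeometry `B` and a subpregeometry `A`, as `LPI`-structures: there are
`L_n`-structures `Ã` and `B̃` on the underlying sets of `A` and `B`, both in `C_n`, such that
`PG(Ã) = A`, `PG(B̃) = B`, `Ã` is a substructure of `B̃`, and `Ã ≤_n B̃`. -/
def PStrong (n : ℕ) (B : Bundled.{w} LPI.Structure) (A : LPI.Substructure B) : Prop :=
  ∃ (sA : (Ln n).Structure A) (sB : (Ln n).Structure B) (hA : InCbar n A) (hB : InCbar n B),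
    Finite B ∧
    (PG n A hA).lpi = FirstOrder.Language.Substructure.inducedStructure ∧
    (PG n B hB).lpi = B.str ∧
    (∀ t : Fin n → A, FirstOrder.Language.Structure.RelMap (Rn n) t ↔
      FirstOrder.Language.Structure.RelMap (Rn n) (fun i => (t i : B))) ∧
    SelfSufficient n (A : Set B)

/-- The class `(P_n, ⊴_n)`: its members are the `A` with `∅ ⊴_n A`. -/
def classP (n : ℕ) : StrongClass.{0, 0, w} LPI where
  mem A := PStrong n A ⊥
  strong := PStrong n

end HrushovskiGeometry

/-!
The general existence and uniqueness of generic models is the usual Fraïssé-style argument. Since a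
member of the class need not be distinguished in itself, embeddings are always pushed one step
further along the chain. Existence (`StrongClass.exists_isGeneric`) takes the limit of a chain whose
`k`-th step solves all extension problems towards the first `k` isomorphism types
(`exists_extension_step`); a problem posed at an early stage is also posed at all later ones by
transitivity, so no further bookkeeping is needed. Uniqueness is a back-and-forth between two chains
(`BackForth`).

For finite relational structures, self-sufficiency passes to free amalgams
(`IsFreeAmalgam.inCbar`, `IsFreeAmalgam.selfSufficient_left`), and a generic structure is the same
thing as a generic model, because it is the union of a chain of finite self-sufficient subsets.

The pregeometry of a structure and its dimension function determine each other: a finite set is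
independent exactly when its dimension equals its cardinality, and the dimension of a finite set is
the size of a largest independent subset (`dim_image_of_indep_iff`, `indep_iff`). The dimension
function of a self-sufficient subset is the restriction of the ambient one. The key fact is then
`Represents.exists_change`: if `A ≤ B`, the relation on `A` may be replaced by any other one with the
same pregeometry, without changing the pregeometry of `B` or the self-sufficiency of `A`. Indeed the
change alters `δ(X)` by an amount depending only on `X ∩ A`, and the value of `δ` on `X ∩ A` can be
traded for the dimension of `X ∩ A` in `A` by enlarging `X` inside `A`. It gives transitivity of `⊴`
(make the structures on the middle term agree), amalgamation for `⊴` (make the structures on the base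
agree, then amalgamate freely), and the extension property of the pregeometry of the generic
structure (amalgamate as pregeometries, restore the original relation on the base, and embed the
resulting structure), so that this pregeometry is a generic model of the class of pregeometries.
-/

namespace HrushovskiGeometry

/-! ### Generic models of amalgamation classes -/

namespace StrongClass

open FirstOrder.Language

variable {L : FirstOrder.Language.{u, v}} {K : StrongClass.{u, v, w} L}

/-- Distinguished embeddings between structures whose carriers are not bundled. -/
def StrongEmb (K : StrongClass.{u, v, w} L) {A B : Type w} [L.Structure A] [L.Structure B]
    (f : A ↪[L] B) : Prop :=
  K.strong ⟨B, inferInstance⟩ f.toHom.range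

section Emb

variable {A B C : Type w} [L.Structure A] [L.Structure B] [L.Structure C]

theorem StrongEmb.equiv_comp (hK : K.IsAdmissible) {f : A ↪[L] B} (hf : K.StrongEmb f)
    (e : B ≃[L] C) : K.StrongEmb (e.toEmbedding.comp f) := by
  have h := hK.strong_iso ⟨B, inferInstance⟩ ⟨C, inferInstance⟩ e _ hf
  unfold StrongEmb
  convert! h using 1
  ext x
  simp [Hom.mem_range, Substructure.mem_map]

theorem StrongEmb.of_range_eq {A' : Type w} [L.Structure A'] {f : A ↪[L] B} (hf : K.StrongEmb f)
    {f' : A' ↪[L] B} (h : f'.toHom.range = f.toHom.range) : K.StrongEmb f' := by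
  unfold StrongEmb
  rw [h]
  exact hf

theorem StrongEmb.comp_equiv {A' : Type w} [L.Structure A'] {f : A ↪[L] B} (hf : K.StrongEmb f)
    (e : A' ≃[L] A) : K.StrongEmb (f.comp e.toEmbedding) := by
  refine hf.of_range_eq ?_
  ext x
  simp only [Hom.mem_range, Embedding.coe_toHom, Embedding.comp_apply]
  exact ⟨fun ⟨y, hy⟩ => ⟨_, hy⟩, fun ⟨y, hy⟩ => ⟨e.symm y, by simpa using hy⟩⟩

theorem strongEmb_subtype_iff {S : L.Substructure A} :
    K.StrongEmb S.subtype ↔ K.strong ⟨A, inferInstance⟩ S := by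
  unfold StrongEmb
  rw [Substructure.range_subtype]

theorem strongIn_iff {S T : L.Substructure A} :
    K.StrongIn S T ↔ ∃ h : S ≤ T, K.StrongEmb (Substructure.inclusion h) := by
  unfold StrongIn StrongEmb
  rw [← exists_prop]
  refine exists_congr fun h => iff_of_eq ?_
  congr 1
  ext x
  simp only [Hom.mem_range, Embedding.coe_toHom, Substructure.mem_comap, Substructure.coe_subtype]
  constructor
  · intro hx
    exact ⟨⟨x, hx⟩, rfl⟩
  · rintro ⟨y, rfl⟩
    exact y.2

/-- For an embedding `f` factoring through `g` as `g ∘ i`, the image of `f` is distinguished in the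
image of `g` exactly when `i` is a distinguished embedding. -/
theorem strongIn_range_iff (hK : K.IsAdmissible) {f : A ↪[L] C} {g : B ↪[L] C} {i : A ↪[L] B}
    (h : ∀ a, f a = g (i a)) : K.StrongIn f.toHom.range g.toHom.range ↔ K.StrongEmb i := by
  have hle : f.toHom.range ≤ g.toHom.range := by
    rintro _ ⟨a, rfl⟩
    exact ⟨i a, (h a).symm⟩
  rw [strongIn_iff]
  have key : ∀ b : A, Substructure.inclusion hle (f.equivRange b) = g.equivRange (i b) := by
    intro b
    ext
    simp [h]
  constructor
  · rintro ⟨h', hs⟩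
    have := (hs.equiv_comp hK g.equivRange.symm).comp_equiv f.equivRange
    convert! this using 1
    ext b
    apply g.equivRange.injective
    simp [key]
  · intro hs
    refine ⟨hle, ?_⟩
    have := (hs.equiv_comp hK g.equivRange).comp_equiv f.equivRange.symm
    convert! this using 1
    ext b
    obtain ⟨b, rfl⟩ := f.equivRange.surjective b
    simp [key]

theorem StrongEmb.comp (hK : K.IsAdmissible) (hT : K.IsTransitive) {f : A ↪[L] B} {g : B ↪[L] C}
    (hg : K.StrongEmb g) (hf : K.StrongEmb f) : K.StrongEmb (g.comp f) :=
  hT ⟨C, inferInstance⟩ _ _ ((strongIn_range_iff hK (f := g.comp f) (fun _ => rfl)).2 hf) hg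

theorem StrongIn.trans (hK : K.IsAdmissible) (hT : K.IsTransitive) {R S T : L.Substructure A}
    (h1 : K.StrongIn R S) (h2 : K.StrongIn S T) : K.StrongIn R T := by
  rw [strongIn_iff] at *
  obtain ⟨h1, e1⟩ := h1
  obtain ⟨h2, e2⟩ := h2
  exact ⟨h1.trans h2, e2.comp hK hT e1⟩

theorem StrongEmb.mem_left (hK : K.IsAdmissible) {f : A ↪[L] B} (hf : K.StrongEmb f) :
    K.mem ⟨A, inferInstance⟩ :=
  hK.mem_iso _ _ ⟨f.equivRange.symm⟩ (hK.mem_of_strong _ _ hf).1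

theorem StrongEmb.mem_right (hK : K.IsAdmissible) {f : A ↪[L] B} (hf : K.StrongEmb f) :
    K.mem ⟨B, inferInstance⟩ :=
  (hK.mem_of_strong _ _ hf).2

theorem Amalgamation.exists_strongEmb (hK : K.IsAdmissible) (hA : K.Amalgamation)
    {f : A ↪[L] B} {g : A ↪[L] C} (hf : K.StrongEmb f) (hg : K.StrongEmb g) :
    ∃ (P : Type w) (_ : L.Structure P) (f' : B ↪[L] P) (g' : C ↪[L] P),
      K.StrongEmb f' ∧ K.StrongEmb g' ∧ ∀ a, f' (f a) = g' (g a) := by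
  obtain ⟨P, f', g', -, h1, h2, h3⟩ := hA ⟨A, inferInstance⟩ ⟨B, inferInstance⟩ ⟨C, inferInstance⟩
    f g (hf.mem_left hK) (hf.mem_right hK) (hg.mem_right hK) hf hg
  exact ⟨P, P.str, f', g', h1, h2, h3⟩

theorem StrongIn.chain_lt (hK : K.IsAdmissible) (hT : K.IsTransitive) {c : ℕ → L.Substructure A}
    (hc : ∀ i, K.StrongIn (c i) (c (i + 1))) {i j : ℕ} (hij : i < j) : K.StrongIn (c i) (c j) := by
  induction j, hij using Nat.le_induction with
  | base => exact hc i
  | succ j _ ih => exact ih.trans hK hT (hc j)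

theorem StrongIn.chain_of_le (hK : K.IsAdmissible) (hT : K.IsTransitive) {c : ℕ → L.Substructure A}
    (hc : ∀ i, K.StrongIn (c i) (c (i + 1))) {S : L.Substructure A} {i j : ℕ} (hij : i ≤ j)
    (hS : K.StrongIn S (c i)) : K.StrongIn S (c j) := by
  rcases hij.eq_or_lt with rfl | h
  · exact hS
  · exact hS.trans hK hT (chain_lt hK hT hc h)

theorem chain_mono {c : ℕ → L.Substructure A} (hc : ∀ i, K.StrongIn (c i) (c (i + 1))) :
    Monotone c :=
  monotone_nat_of_le_succ fun i => (hc i).1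

end Emb

/-! ### Uniqueness of generic models -/

section Uniqueness

variable {M N : Type w} [L.Structure M] [L.Structure N]

/-- The property of a chain of substructures which makes its union a generic model. -/
structure IsGenericChain (K : StrongClass.{u, v, w} L) (c : ℕ → L.Substructure M) : Prop where
  strong : ∀ i, K.StrongIn (c i) (c (i + 1))
  union : ∀ x : M, ∃ i, x ∈ c i
  extension : ∀ (i : ℕ) (A : L.Substructure M), K.StrongIn A (c i) →
      ∀ (B : Bundled.{w} L.Structure) (g : A ↪[L] B), K.mem B → K.IsStrongEmb g →
        ∃ (j : ℕ) (f : B ↪[L] M), (∀ a : A, f (g a) = a) ∧ K.StrongIn f.toHom.range (c j)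

/-- The partial isomorphisms used in the back-and-forth argument: those whose domain and codomain
are distinguished in members of the two chains. -/
def BackForth (K : StrongClass.{u, v, w} L) (c : ℕ → L.Substructure M)
    (d : ℕ → L.Substructure N) : Type _ :=
  {f : M ≃ₚ[L] N // (∃ i, K.StrongIn f.dom (c i)) ∧ ∃ j, K.StrongIn f.cod (d j)}

instance (c : ℕ → L.Substructure M) (d : ℕ → L.Substructure N) : Preorder (BackForth K c d) :=
  inferInstanceAs (Preorder (Subtype _))

/-- The inverse of a partial isomorphism in the back-and-forth system. -/
def BackForth.symm {c : ℕ → L.Substructure M} {d : ℕ → L.Substructure N} (f : BackForth K c d) :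
    BackForth K d c :=
  ⟨f.1.symm, f.2.2, f.2.1⟩

/-- The forth step: a partial isomorphism in the system extends to one defined at a given point. -/
theorem BackForth.exists_dom (hK : K.IsAdmissible) (hT : K.IsTransitive)
    {c : ℕ → L.Substructure M} {d : ℕ → L.Substructure N} (hc : K.IsGenericChain c)
    (hd : K.IsGenericChain d) (f : BackForth K c d) (x : M) :
    ∃ g : BackForth K c d, x ∈ g.1.dom ∧ f ≤ g := by
  obtain ⟨f, ⟨i, hi⟩, ⟨j, hj⟩⟩ := f
  obtain ⟨k, hk⟩ := hc.union x
  -- A successor index is used because a member of the chain need not be distinguished in itself.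
  set m := max i k + 1
  have hdom : K.StrongIn f.dom (c m) := hi.chain_of_le hK hT hc.strong (by omega)
  obtain ⟨hle, hs⟩ := strongIn_iff.1 hdom
  have hg : K.StrongEmb ((Substructure.inclusion hle).comp f.toEquiv.symm.toEmbedding) :=
    hs.comp_equiv _
  obtain ⟨j', f', hf', hj'⟩ := hd.extension j f.cod hj ⟨c m, inferInstance⟩ _ (hg.mem_right hK) hg
  refine ⟨⟨⟨c m, f'.toHom.range, f'.equivRange⟩, ⟨m + 1, hc.strong m⟩, ⟨j', hj'⟩⟩,
    chain_mono hc.strong (by omega) hk, ?_⟩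
  refine PartialEquiv.le_def _ _ |>.2 ⟨hle, ?_⟩
  ext a
  have h := hf' (f.toEquiv a)
  simpa using h

theorem BackForth.exists_cod (hK : K.IsAdmissible) (hT : K.IsTransitive)
    {c : ℕ → L.Substructure M} {d : ℕ → L.Substructure N} (hc : K.IsGenericChain c)
    (hd : K.IsGenericChain d) (f : BackForth K c d) (y : N) :
    ∃ g : BackForth K c d, y ∈ g.1.cod ∧ f ≤ g := by
  obtain ⟨g, hy, hg⟩ := f.symm.exists_dom hK hT hd hc y
  exact ⟨g.symm, hy, PartialEquiv.symm_le_iff.1 hg⟩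

theorem nonempty_equiv_of_isGenericChain [L.IsRelational] [IsEmpty (L.Relations 0)]
    (hK : K.IsAdmissible) (hE : K.EmptyStrong) (hT : K.IsTransitive)
    {c : ℕ → L.Substructure M} {d : ℕ → L.Substructure N} (hc : K.IsGenericChain c)
    (hd : K.IsGenericChain d) [Countable M] [Countable N] : Nonempty (M ≃[L] N) := by
  have _ : Encodable M := Encodable.ofCountable M
  have _ : Encodable N := Encodable.ofCountable N
  have hbot : ∀ {M : Type w} [L.Structure M] {c : ℕ → L.Substructure M}, K.IsGenericChain c →
      K.StrongIn ⊥ (c 0) := by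
    intro M _ c hc
    refine ⟨bot_le, ?_⟩
    have := hE _ ((strongIn_iff.1 (hc.strong 0)).2.mem_left hK)
    convert! this using 1
    ext x
    simp [Substructure.mem_comap, ← Substructure.closure_empty]
  let start : BackForth K c d :=
    ⟨(default : L.FGEquiv M N).1, ⟨0, hbot hc⟩, ⟨0, hbot hd⟩⟩
  let D : M ⊕ N → Order.Cofinal (BackForth K c d) := fun p => Sum.recOn p
    (fun x => ⟨{f | x ∈ f.1.dom}, fun f => f.exists_dom hK hT hc hd x⟩)
    (fun y => ⟨{f | y ∈ f.1.cod}, fun f => f.exists_cod hK hT hc hd y⟩)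
  let S : ℕ →o M ≃ₚ[L] N :=
    ⟨fun i => (Order.sequenceOfCofinals start D i).1,
      fun i j hij => Order.sequenceOfCofinals.monotone start D hij⟩
  let F := DirectLimit.partialEquivLimit S
  have hdom : F.dom = ⊤ := by
    refine top_le_iff.1 fun x _ => ?_
    exact PartialEquiv.dom_le_dom (DirectLimit.le_partialEquivLimit S _)
      (Order.sequenceOfCofinals.encode_mem start D (Sum.inl x))
  have hcod : F.cod = ⊤ := by
    refine top_le_iff.1 fun y _ => ?_
    exact PartialEquiv.cod_le_cod (DirectLimit.le_partialEquivLimit S _)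
      (Order.sequenceOfCofinals.encode_mem start D (Sum.inr y))
  exact ⟨PartialEquiv.toEquivOfEqTop hdom hcod⟩

end Uniqueness

theorem IsGeneric.exists_chain {M : Bundled.{w} L.Structure} (h : K.IsGeneric M) :
    ∃ c : ℕ → L.Substructure M, K.IsGenericChain c := by
  obtain ⟨-, c, -, h1, h2, h3⟩ := h
  exact ⟨c, h1, h2, h3⟩

theorem IsGenericChain.isGeneric (hK : K.IsAdmissible) {M : Type w} [L.Structure M] [Countable M]
    {c : ℕ → L.Substructure M} (h : K.IsGenericChain c) : K.IsGeneric ⟨M, inferInstance⟩ :=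
  ⟨inferInstance, c, fun i => (strongIn_iff.1 (h.strong i)).2.mem_left hK, h.strong, h.union,
    h.extension⟩

theorem IsGeneric.nonempty_equiv [L.IsRelational] [IsEmpty (L.Relations 0)] (hK : K.IsAdmissible)
    (hE : K.EmptyStrong) (hT : K.IsTransitive) {M N : Bundled.{w} L.Structure} (hM : K.IsGeneric M)
    (hN : K.IsGeneric N) : Nonempty (M ≃[L] N) := by
  obtain ⟨c, hc⟩ := hM.exists_chain
  obtain ⟨d, hd⟩ := hN.exists_chain
  have := hM.1
  have := hN.1
  exact nonempty_equiv_of_isGenericChain hK hE hT hc hd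

/-! ### Existence of generic models -/

/-- Every member `A` has a distinguished extension `P` which realizes at once all
one-step extension problems over substructures `S ≤ A` towards the first `k` members of a given
list `T`. -/
theorem exists_extension_step (hK : K.IsAdmissible) (hE : K.EmptyStrong) (hT : K.IsTransitive)
    (hA : K.Amalgamation) (T : ℕ → Bundled.{w} L.Structure) (hTm : ∀ j, K.mem (T j))
    (A : Bundled.{w} L.Structure) (hAm : K.mem A) (k : ℕ) :
    ∃ (P : Bundled.{w} L.Structure) (f : A ↪[L] P), K.mem P ∧ K.StrongEmb f ∧
      ∀ (S : L.Substructure A), K.strong A S → ∀ j < k, ∀ g : S ↪[L] T j, K.StrongEmb g →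
        ∃ f' : T j ↪[L] P, K.StrongEmb f' ∧ ∀ a : S, f' (g a) = f a := by
  have := hK.finite A hAm
  have := fun j => hK.finite _ (hTm j)
  let Task := Σ (S : L.Substructure A) (j : Fin k), S ↪[L] T j
  have : Finite (L.Substructure A) := Finite.of_injective _ SetLike.coe_injective
  have : ∀ (S : L.Substructure A) (j : Fin k), Finite (S ↪[L] T j) :=
    fun S j => Finite.of_injective _ DFunLike.coe_injective
  have : Finite Task := inferInstance
  have key : ∀ s : Set Task, s.Finite → ∃ (P : Type w) (_ : L.Structure P) (f : A ↪[L] P),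
      K.StrongEmb f ∧ ∀ t ∈ s, K.strong A t.1 → K.StrongEmb t.2.2 →
        ∃ f' : T t.2.1 ↪[L] P, K.StrongEmb f' ∧ ∀ a : t.1, f' (t.2.2 a) = f a := by
    intro s hs
    induction s, hs using Set.Finite.induction_on with
    | empty =>
      have h := strongEmb_subtype_iff.2 (hE A hAm)
      obtain ⟨P, sP, f, -, hf, -⟩ := hA.exists_strongEmb hK h h
      exact ⟨P, sP, f, hf, by simp⟩
    | @insert t s _ _ ih =>
      obtain ⟨P, sP, f, hf, hs⟩ := ih
      by_cases ht : K.strong A t.1 ∧ K.StrongEmb t.2.2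
      · obtain ⟨Q, sQ, p, q, hp, hq, hpq⟩ :=
          hA.exists_strongEmb hK (hf.comp hK hT (strongEmb_subtype_iff.2 ht.1)) ht.2
        refine ⟨Q, sQ, p.comp f, hp.comp hK hT hf, ?_⟩
        rintro t' (rfl | ht') h1 h2
        · exact ⟨q, hq, fun a => (hpq a).symm⟩
        · obtain ⟨f', hf', h⟩ := hs t' ht' h1 h2
          exact ⟨p.comp f', hp.comp hK hT hf', fun a => by simp [h]⟩
      · refine ⟨P, sP, f, hf, ?_⟩
        rintro t' (rfl | ht') h1 h2
        · exact absurd ⟨h1, h2⟩ ht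
        · exact hs t' ht' h1 h2
  obtain ⟨P, sP, f, hf, h⟩ := key Set.univ Set.finite_univ
  exact ⟨⟨P, sP⟩, f, hf.mem_right hK, hf,
    fun S hS j hj g hg => h ⟨S, ⟨j, hj⟩, g⟩ trivial hS hg⟩

theorem exists_isGeneric (hK : K.IsAdmissible) (hE : K.EmptyStrong) (hT : K.IsTransitive)
    (hA : K.Amalgamation) : ∃ M : Bundled.{w} L.Structure, K.IsGeneric M := by
  -- Enumerate representatives of the isomorphism types of members.
  obtain ⟨T, hTm, hTs⟩ : ∃ T : ℕ → Bundled.{w} L.Structure, (∀ j, K.mem (T j)) ∧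
      ∀ A, K.mem A → ∃ j, Nonempty (A ≃[L] T j) := by
    obtain ⟨T, hTc, hT⟩ := hK.countable
    have hc : (T ∩ {A | K.mem A}).Countable := hTc.mono Set.inter_subset_left
    have hne : (T ∩ {A | K.mem A}).Nonempty := by
      obtain ⟨A, hA⟩ := hK.nonempty
      obtain ⟨B, hB, ⟨e⟩⟩ := hT A hA
      exact ⟨B, hB, hK.mem_iso _ _ ⟨e⟩ hA⟩
    obtain ⟨e, he⟩ := hc.exists_eq_range hne
    refine ⟨e, fun j => ?_, fun A hA => ?_⟩
    · exact (he.symm ▸ Set.mem_range_self j : e j ∈ T ∩ {A | K.mem A}).2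
    · obtain ⟨B, hB, ⟨f⟩⟩ := hT A hA
      obtain ⟨j, rfl⟩ := (he ▸ ⟨hB, hK.mem_iso _ _ ⟨f⟩ hA⟩ : B ∈ Set.range e)
      exact ⟨j, ⟨f⟩⟩
  obtain ⟨A₀, hA₀⟩ := hK.nonempty
  choose P p hPm hp hPe using exists_extension_step hK hE hT hA T hTm
  let G' : ℕ → {A // K.mem A} := Nat.rec ⟨A₀, hA₀⟩ fun k A => ⟨P A.1 A.2 k, hPm A.1 A.2 k⟩
  let G : ℕ → Type w := fun k => (G' k).1
  let φ : ∀ k, G k ↪[L] G (k + 1) := fun k => p (G' k).1 (G' k).2 k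
  have hφ : ∀ k, K.StrongEmb (φ k) := fun k => hp (G' k).1 (G' k).2 k
  let M := Language.DirectLimit G (DirectedSystem.natLERec φ)
  let o : ∀ k, G k ↪[L] M := fun k => Language.DirectLimit.of L ℕ G (DirectedSystem.natLERec φ) k
  have ho : ∀ k x, o (k + 1) (φ k x) = o k x := by
    intro k x
    have := Language.DirectLimit.of_f (L := L) (G := G) (f := DirectedSystem.natLERec φ)
      (hij := Nat.le_succ k) (x := x)
    rw [← this]
    congr 1
    rw [DirectedSystem.coe_natLERec]
    exact (Nat.leRecOn_succ' (C := G) (next := fun {k} => φ k) x).symm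
  have hfin : ∀ k, Finite (G k) := fun k => hK.finite _ (G' k).2
  let c : ℕ → L.Substructure M := fun k => (o k).toHom.range
  have hcov : ∀ x : M, ∃ i, x ∈ c i := by
    intro x
    obtain ⟨i, y, rfl⟩ := Language.DirectLimit.exists_of x
    exact ⟨i, y, rfl⟩
  have hc : ∀ i, K.StrongIn (c i) (c (i + 1)) := fun i =>
    (strongIn_range_iff hK (i := φ i) fun a => (ho i a).symm).2 (hφ i)
  have : Countable M := by
    have : Function.Surjective (fun x : Σ i, G i => o x.1 x.2) := by
      intro x
      obtain ⟨i, y, rfl⟩ := hcov x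
      exact ⟨⟨i, y⟩, rfl⟩
    exact this.countable
  refine ⟨⟨M, inferInstance⟩, IsGenericChain.isGeneric hK (c := c) ⟨hc, hcov, ?_⟩⟩
  intro i A hA B g hB hg
  obtain ⟨j, ⟨e⟩⟩ := hTs B hB
  set k := max i j + 1
  have hAk : K.StrongIn A (c k) := hA.chain_of_le hK hT hc (by omega)
  -- The copy of `A` in the finite stage `G k`.
  let r : A ↪[L] G k := (o k).equivRange.symm.toEmbedding.comp (Substructure.inclusion hAk.1)
  have hr : ∀ a : A, o k (r a) = a := fun a => by
    have : ((o k).equivRange (r a) : M) = a := by simp [r]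
    simpa using this
  have hrs : K.StrongEmb r := (strongIn_iff.1 hAk).2.equiv_comp hK _
  let g' : r.toHom.range ↪[L] T j :=
    e.toEmbedding.comp (g.comp r.equivRange.symm.toEmbedding)
  have hg' : K.StrongEmb g' :=
    StrongEmb.equiv_comp hK (StrongEmb.comp_equiv (A := A) (B := B) hg _) e
  obtain ⟨f', hf', hfe⟩ := hPe (G' k).1 (G' k).2 k r.toHom.range hrs j (by omega) g' hg'
  let f'' : T j ↪[L] G (k + 1) := f'
  refine ⟨k + 1, ((o (k + 1)).comp f'').comp e.toEmbedding, fun a => ?_, ?_⟩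
  · have h := hfe (r.equivRange a)
    have h' : f'' (e (g a)) = φ k (r a) := by simpa [g'] using h
    simp [h', ho, hr]
  · refine (strongIn_range_iff hK (i := f''.comp e.toEmbedding) fun a => rfl).2 ?_
    exact StrongEmb.comp_equiv (A := T j) hf' e

end StrongClass

/-! ### Predimension, dimension and independence -/

section Dimension

variable {n : ℕ} {M N : Type w} [(Ln n).Structure M] [(Ln n).Structure N]

theorem delta_le_ncard (X : Set M) : delta n X ≤ X.ncard := by
  unfold delta
  omega

theorem dim_le_ncard (h : InCbar n M) {X : Set M} (hX : X.Finite) : dim n X ≤ X.ncard :=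
  (dim_le h hX subset_rfl).trans (delta_le_ncard X)

theorem dim_nonneg (h : InCbar n M) {X : Set M} (hX : X.Finite) : 0 ≤ dim n X := by
  obtain ⟨B, hB, -, e⟩ := dim_attained h hX
  exact e ▸ h B hB

theorem dim_empty (h : InCbar n M) : dim n (∅ : Set M) = 0 := by
  have h1 := dim_le_ncard h (Set.finite_empty (α := M))
  have h2 := dim_nonneg h (Set.finite_empty (α := M))
  rw [Set.ncard_empty] at h1
  omega

/-- A finite set is independent exactly when its dimension is its cardinality. -/
theorem dim_eq_ncard_iff (h : InCbar n M) {Y : Set M} (hY : Y.Finite) :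
    dim n Y = Y.ncard ↔ ∀ y ∈ Y, y ∉ dcl n (Y \ {y}) := by
  constructor
  · intro e y hy hyd
    rw [dcl_finite_iff h hY.sdiff, Set.insert_sdiff_singleton, Set.insert_eq_of_mem hy] at hyd
    have h1 := dim_le_ncard h (hY.sdiff (t := {y}))
    have h2 := Set.ncard_sdiff_singleton_lt_of_mem hy hY
    omega
  · intro hind
    suffices ∀ Z : Set M, Z.Finite → Z ⊆ Y → dim n Z = Z.ncard from this Y hY subset_rfl
    intro Z hZ
    induction Z, hZ using Set.Finite.induction_on with
    | empty => simp [dim_empty h]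
    | @insert y Z hyZ hZ ih =>
      intro hsub
      have ih := ih ((Set.subset_insert y Z).trans hsub)
      have h1 : dim n (insert y Z) ≠ dim n Z := by
        intro e
        refine hind y (hsub (Set.mem_insert y Z)) (dcl_mono ?_ ((dcl_finite_iff h hZ).2 e))
        exact fun z hz => ⟨hsub (Or.inr hz), fun hzy => hyZ (hzy ▸ hz)⟩
      have h2 := dim_insert_le h hZ y
      have h3 := dim_mono h (hZ.insert y) (Set.subset_insert y Z)
      rw [Set.ncard_insert_of_notMem hyZ hZ]
      omega

theorem indep_iff (h : InCbar n M) {k : ℕ} (a : Fin k → M) :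
    (PG n M h).Indep a ↔ Function.Injective a ∧ dim n (Set.range a) = k := by
  have himg : Function.Injective a → ∀ i, a '' {j | j ≠ i} = Set.range a \ {a i} := by
    intro ha i
    ext x
    constructor
    · rintro ⟨j, hj, rfl⟩
      exact ⟨⟨j, rfl⟩, fun e => hj (ha e)⟩
    · rintro ⟨⟨j, rfl⟩, hj⟩
      exact ⟨j, fun e => hj (e ▸ rfl), rfl⟩
  have hcard : Function.Injective a → (Set.range a).ncard = k := by
    intro ha
    rw [← Set.image_univ, Set.ncard_image_of_injective _ ha, Set.ncard_univ, Nat.card_fin]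
  constructor
  · intro hind
    have ha : Function.Injective a := by
      intro i j hij
      by_contra hne
      exact hind i (subset_dcl _ ⟨j, fun e => hne e.symm, hij.symm⟩)
    refine ⟨ha, ?_⟩
    have := (dim_eq_ncard_iff h (Set.finite_range a)).2 (by
      rintro _ ⟨i, rfl⟩
      rw [← himg ha i]
      exact hind i)
    rw [this, hcard ha]
  · rintro ⟨ha, e⟩ i
    rw [himg ha i]
    refine (dim_eq_ncard_iff h (Set.finite_range a)).1 ?_ _ ⟨i, rfl⟩
    rw [e, hcard ha]

/-- Every finite set has an independent subset of the same dimension. -/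
theorem exists_basis (h : InCbar n M) {X : Set M} (hX : X.Finite) :
    ∃ Y ⊆ X, dim n Y = Y.ncard ∧ dim n Y = dim n X := by
  induction X, hX using Set.Finite.induction_on with
  | empty => exact ⟨∅, subset_rfl, by simp [dim_empty h], rfl⟩
  | @insert c X hcX hX ih =>
    obtain ⟨Y, hYX, h1, h2⟩ := ih
    have hY := hX.subset hYX
    have h3 := dim_mono h (hX.insert c) (Set.subset_insert c X)
    by_cases hc : dim n (insert c X) = dim n X
    · exact ⟨Y, hYX.trans (Set.subset_insert c X), h1, h2.trans hc.symm⟩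
    · refine ⟨insert c Y, Set.insert_subset_insert hYX, ?_⟩
      have h4 := dim_submodular h hX (hY.insert c) hYX (Set.subset_insert c Y)
      rw [Set.union_insert, Set.union_eq_self_of_subset_right hYX] at h4
      have h5 := dim_insert_le h hX c
      have h6 := dim_insert_le h hY c
      rw [Set.ncard_insert_of_notMem (fun hc => hcX (hYX hc)) hY]
      omega

/-- An injective map which preserves and reflects independent tuples preserves dimension, as the
dimension of a finite set is the size of its largest independent subset. -/
theorem dim_image_of_indep_iff (hM : InCbar n M) (hN : InCbar n N) {f : M → N}
    (hf : Function.Injective f)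
    (hind : ∀ (k : ℕ) (a : Fin (k + 1) → M),
      (PG n M hM).Indep a ↔ (PG n N hN).Indep (f ∘ a)) {X : Set M} (hX : X.Finite) :
    dim n (f '' X) = dim n X := by
  have key : ∀ Y : Set M, Y.Finite → (dim n (f '' Y) = Y.ncard ↔ dim n Y = Y.ncard) := by
    intro Y hY
    obtain ⟨k, a, ha, rfl⟩ := hY.fin_param
    have hcard : (Set.range a).ncard = k := by
      rw [← Set.image_univ, Set.ncard_image_of_injective _ ha, Set.ncard_univ, Nat.card_fin]
    rcases k with _ | k
    · simp [Set.range_eq_empty, dim_empty hM, dim_empty hN]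
    · have := hind k a
      rw [indep_iff, indep_iff, Set.range_comp] at this
      simp only [ha, hf.comp ha, true_and] at this
      rw [hcard, this]
  obtain ⟨Y, hYX, h1, h2⟩ := exists_basis hM hX
  obtain ⟨Z, hZX, h3, h4⟩ := exists_basis hN (hX.image f)
  obtain ⟨Z, hZX', rfl⟩ := (Set.subset_image_iff).1 hZX
  rw [Set.ncard_image_of_injective _ hf] at h3
  have h5 := (key Z (hX.subset hZX')).1 h3
  have h6 := (key Y (hX.subset hYX)).2 h1
  have h7 := dim_mono hM hX hZX'
  have h8 := dim_mono hN (hX.image f) (Set.image_mono hYX)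
  omega

/-- Conversely, an injection which preserves dimension preserves and reflects independence. -/
theorem indep_comp_iff_of_dim_image (hM : InCbar n M) (hN : InCbar n N) {f : M → N}
    (hf : Function.Injective f) (hdim : ∀ X : Set M, X.Finite → dim n (f '' X) = dim n X)
    {k : ℕ} (a : Fin k → M) : (PG n M hM).Indep a ↔ (PG n N hN).Indep (f ∘ a) := by
  rw [indep_iff, indep_iff, Set.range_comp, hdim _ (Set.finite_range a), hf.of_comp_iff]

end Dimension

/-! ### Embeddings and self-sufficient sets -/

section Embeddings

instance (n : ℕ) : (Ln n).IsRelational := fun _ => inferInstanceAs (IsEmpty Empty)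

instance : LPI.IsRelational := fun _ => inferInstanceAs (IsEmpty Empty)

instance : IsEmpty (LPI.Relations 0) := ⟨fun r => nomatch r⟩

theorem isEmpty_Ln_relations_zero {n : ℕ} (hn : 0 < n) : IsEmpty ((Ln n).Relations 0) := by
  refine ⟨fun r => ?_⟩
  have : ∀ k, LnRel n k → k = n := fun k r => by cases r; rfl
  have := this 0 r
  omega

variable {n : ℕ} {M N : Type w}

/-- The `L_n`-structure in which the relation is a given predicate on tuples. -/
@[reducible]
def structureOfRel (R : (Fin n → M) → Prop) : (Ln n).Structure M where
  funMap := fun {_} f => Empty.elim f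
  RelMap := fun {_} r => match r with
    | LnRel.R => R

variable [(Ln n).Structure M] [(Ln n).Structure N]

/-- An injection preserving and reflecting the relation is an embedding. -/
@[reducible]
def embeddingOfRel (f : M → N) (hf : Function.Injective f)
    (hR : ∀ t : Fin n → M, FirstOrder.Language.Structure.RelMap (Rn n) (f ∘ t) ↔
      FirstOrder.Language.Structure.RelMap (Rn n) t) : M ↪[Ln n] N where
  toFun := f
  inj' := hf
  map_fun' := fun {_} g => Empty.elim g
  map_rel' := fun {_} r => match r with
    | LnRel.R => hR

theorem delta_image (f : M ↪[Ln n] N) (X : Set M) : delta n (f '' X) = delta n X := by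
  have h : relSet n (f '' X) = (fun t : Fin n → M => f ∘ t) '' relSet n X := by
    ext t
    constructor
    · rintro ⟨ht, hX⟩
      choose u hu hut using hX
      have e : f ∘ u = t := funext hut
      refine ⟨u, ⟨?_, hu⟩, e⟩
      rw [← e] at ht
      exact (f.map_rel _ _).1 ht
    · rintro ⟨u, ⟨hu, hX⟩, rfl⟩
      exact ⟨(f.map_rel _ _).2 hu, fun i => ⟨u i, hX i, rfl⟩⟩
  have hinj : Function.Injective (fun t : Fin n → M => f ∘ t) := f.injective.comp_left
  unfold delta
  rw [h, Set.ncard_image_of_injective _ f.injective, Set.ncard_image_of_injective _ hinj]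

theorem InCbar.of_embedding (h : InCbar n N) (f : M ↪[Ln n] N) : InCbar n M := fun X hX =>
  delta_image f X ▸ h _ (hX.image f)

theorem SelfSufficient.delta_inter_le {A : Set M} (hA : SelfSufficient n A) {X : Set M}
    (hX : X.Finite) : delta n (X ∩ A) ≤ delta n X := by
  have h1 := delta_submodular (n := n) hX hA.1
  have h2 := hA.2 _ (hX.union hA.1) Set.subset_union_right
  omega

theorem exists_selfSufficient (h : InCbar n M) {A : Set M} (hA : A.Finite) :
    ∃ B, A ⊆ B ∧ SelfSufficient n B := by
  obtain ⟨B, hB, hAB, e⟩ := dim_attained h hA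
  exact ⟨B, hAB, hB, fun C hC hBC => e ▸ dim_le h hC (hAB.trans hBC)⟩

theorem SelfSufficient.of_image (f : M ↪[Ln n] N) {A : Set M} (h : SelfSufficient n (f '' A)) :
    SelfSufficient n A := by
  refine ⟨h.1.of_finite_image f.injective.injOn, fun B hB hAB => ?_⟩
  rw [← delta_image f A, ← delta_image f B]
  exact h.2 _ (hB.image f) (Set.image_mono hAB)

theorem SelfSufficient.image {f : M ↪[Ln n] N} (hf : SelfSufficient n (Set.range f)) {A : Set M}
    (hA : SelfSufficient n A) : SelfSufficient n (f '' A) := by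
  refine ⟨hA.1.image f, fun B hB hAB => ?_⟩
  have h1 := hf.delta_inter_le hB
  have h2 : f '' (f ⁻¹' B) = B ∩ Set.range f := Set.image_preimage_eq_inter_range
  rw [← h2, delta_image] at h1
  rw [delta_image]
  exact (hA.2 _ (hB.preimage f.injective.injOn) (Set.image_subset_iff.1 hAB)).trans h1

theorem SelfSufficient.dim_image (hM : InCbar n M) (hN : InCbar n N) {f : M ↪[Ln n] N}
    (hf : SelfSufficient n (Set.range f)) {X : Set M} (hX : X.Finite) :
    dim n (f '' X) = dim n X := by
  apply le_antisymm
  · obtain ⟨B, hB, hXB, e⟩ := dim_attained hM hX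
    rw [← e, ← delta_image f]
    exact dim_le hN (hB.image f) (Set.image_mono hXB)
  · obtain ⟨B, hB, hXB, e⟩ := dim_attained hN (hX.image f)
    have h1 := hf.delta_inter_le hB
    have h2 : f '' (f ⁻¹' B) = B ∩ Set.range f := Set.image_preimage_eq_inter_range
    rw [← h2, delta_image] at h1
    exact (dim_le hM (hB.preimage f.injective.injOn) (Set.image_subset_iff.1 hXB)).trans (e ▸ h1)

end Embeddings

/-! ### Replacing the structure on a self-sufficient set -/

section Change

variable {n : ℕ} {M : Type w} {s s' : (Ln n).Structure M} {A : Set M}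

/-- The tuples of `X` not contained in `A` contribute equally to the predimension in two structures
which agree on them. -/
theorem delta_sub_delta_inter
    (hag : ∀ t : Fin n → M, (¬ ∀ i, t i ∈ A) → (s.RelMap (Rn n) t ↔ s'.RelMap (Rn n) t))
    {X : Set M} (hX : X.Finite) :
    @delta n M s' X - @delta n M s' (X ∩ A) = @delta n M s X - @delta n M s (X ∩ A) := by
  have hsub : ∀ s : (Ln n).Structure M, @relSet n M s (X ∩ A) ⊆ @relSet n M s X :=
    fun s t ht => ⟨ht.1, fun i => (ht.2 i).1⟩
  have h1 := Set.ncard_sdiff_add_ncard_of_subset (hsub s) (@relSet_finite n M s X hX)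
  have h2 := Set.ncard_sdiff_add_ncard_of_subset (hsub s') (@relSet_finite n M s' X hX)
  have h3 : @relSet n M s X \ @relSet n M s (X ∩ A) =
      @relSet n M s' X \ @relSet n M s' (X ∩ A) := by
    ext t
    constructor
    · rintro ⟨⟨hR, hX⟩, hn⟩
      have hA : ¬ ∀ i, t i ∈ A := fun hA => hn ⟨hR, fun i => ⟨hX i, hA i⟩⟩
      exact ⟨⟨(hag t hA).1 hR, hX⟩, fun h => hA fun i => (h.2 i).2⟩
    · rintro ⟨⟨hR, hX⟩, hn⟩
      have hA : ¬ ∀ i, t i ∈ A := fun hA => hn ⟨hR, fun i => ⟨hX i, hA i⟩⟩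
      exact ⟨⟨(hag t hA).2 hR, hX⟩, fun h => hA fun i => (h.2 i).2⟩
  rw [h3] at h1
  unfold delta
  omega

theorem inCbar_of_change
    (hag : ∀ t : Fin n → M, (¬ ∀ i, t i ∈ A) → (s.RelMap (Rn n) t ↔ s'.RelMap (Rn n) t))
    (hA : @SelfSufficient n M s A)
    (hpos : ∀ X ⊆ A, 0 ≤ @delta n M s' X) : @InCbar n M s' := by
  intro X hX
  have h1 := delta_sub_delta_inter hag hX
  have h2 := @SelfSufficient.delta_inter_le n M s A hA X hX
  have h3 := hpos (X ∩ A) Set.inter_subset_right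
  omega

theorem selfSufficient_of_change
    (hag : ∀ t : Fin n → M, (¬ ∀ i, t i ∈ A) → (s.RelMap (Rn n) t ↔ s'.RelMap (Rn n) t))
    (hA : @SelfSufficient n M s A) : @SelfSufficient n M s' A := by
  refine ⟨hA.1, fun B hB hAB => ?_⟩
  have h1 := delta_sub_delta_inter hag hB
  have h2 := hA.2 B hB hAB
  rw [Set.inter_eq_self_of_subset_right hAB] at h1
  omega

/-- If every subset `X` of `A` can be enlarged inside `A` to one whose new predimension is at most the
old predimension of `X`, then dimensions do not increase. Applied in both directions, this shows that
dimensions only depend on the dimension function of `A`. -/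
theorem dim_le_of_change
    (hag : ∀ t : Fin n → M, (¬ ∀ i, t i ∈ A) → (s.RelMap (Rn n) t ↔ s'.RelMap (Rn n) t))
    (hAf : A.Finite) (h : @InCbar n M s) (h' : @InCbar n M s')
    (hd : ∀ X ⊆ A, ∃ Z, X ⊆ Z ∧ Z ⊆ A ∧ @delta n M s' Z ≤ @delta n M s X)
    {X : Set M} (hX : X.Finite) : @dim n M s' X ≤ @dim n M s X := by
  obtain ⟨Y, hY, hXY, e⟩ := @dim_attained n M s h X hX
  obtain ⟨Z, hYZ, hZA, hZ⟩ := hd (Y ∩ A) Set.inter_subset_right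
  have hZf := hAf.subset hZA
  have h1 := @delta_submodular n M s' Y Z hY hZf
  have h2 : Y ∩ Z = Y ∩ A :=
    Set.Subset.antisymm (Set.inter_subset_inter_right Y hZA)
      (Set.subset_inter Set.inter_subset_left hYZ)
  have h3 := @dim_le n M s' h' X (Y ∪ Z) (hY.union hZf) (hXY.trans Set.subset_union_left)
  have h4 := delta_sub_delta_inter hag hY
  rw [h2] at h1
  omega

end Change

/-! ### Free amalgamation -/

section FreeAmalgam

variable {n : ℕ} {A₀ A₁ A₂ P : Type w} [(Ln n).Structure A₀] [(Ln n).Structure A₁]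
  [(Ln n).Structure A₂] [(Ln n).Structure P]

/-- `P` is the free amalgam of `A₁` and `A₂` over `A₀`: it is their union, they meet exactly in
`A₀`, and every related tuple lies in one of them. -/
structure IsFreeAmalgam (g₁ : A₀ ↪[Ln n] A₁) (g₂ : A₀ ↪[Ln n] A₂) (f₁ : A₁ ↪[Ln n] P)
    (f₂ : A₂ ↪[Ln n] P) : Prop where
  comm : ∀ a, f₁ (g₁ a) = f₂ (g₂ a)
  union : ∀ x, x ∈ Set.range f₁ ∨ x ∈ Set.range f₂
  inter : ∀ a b, f₁ a = f₂ b → ∃ c, g₁ c = a ∧ g₂ c = b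
  rel : ∀ t : Fin n → P, FirstOrder.Language.Structure.RelMap (Rn n) t →
    (∀ i, t i ∈ Set.range f₁) ∨ ∀ i, t i ∈ Set.range f₂

namespace IsFreeAmalgam

variable {g₁ : A₀ ↪[Ln n] A₁} {g₂ : A₀ ↪[Ln n] A₂} {f₁ : A₁ ↪[Ln n] P} {f₂ : A₂ ↪[Ln n] P}

theorem symm (h : IsFreeAmalgam g₁ g₂ f₁ f₂) : IsFreeAmalgam g₂ g₁ f₂ f₁ where
  comm a := (h.comm a).symm
  union x := (h.union x).symm
  inter a b e := by
    obtain ⟨c, h1, h2⟩ := h.inter b a e.symm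
    exact ⟨c, h2, h1⟩
  rel t ht := (h.rel t ht).symm

/-- Submodularity of the predimension is an equality in a free amalgam. -/
theorem delta_eq (h : IsFreeAmalgam g₁ g₂ f₁ f₂) {Y : Set P} (hY : Y.Finite) :
    delta n Y + delta n (f₂ ⁻¹' Y ∩ Set.range g₂) = delta n (f₁ ⁻¹' Y) + delta n (f₂ ⁻¹' Y) := by
  have e1 : f₁ '' (f₁ ⁻¹' Y) = Y ∩ Set.range f₁ := Set.image_preimage_eq_inter_range
  have e2 : f₂ '' (f₂ ⁻¹' Y) = Y ∩ Set.range f₂ := Set.image_preimage_eq_inter_range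
  have e3 : f₂ '' (f₂ ⁻¹' Y ∩ Set.range g₂) = (Y ∩ Set.range f₁) ∩ (Y ∩ Set.range f₂) := by
    ext x
    constructor
    · rintro ⟨_, ⟨hx, c, rfl⟩, rfl⟩
      exact ⟨⟨hx, g₁ c, h.comm c⟩, hx, _, rfl⟩
    · rintro ⟨⟨hx, a, ha⟩, -, b, rfl⟩
      obtain ⟨c, -, hc⟩ := h.inter a b ha
      exact ⟨b, ⟨hx, c, hc⟩, rfl⟩
  have e4 : (Y ∩ Set.range f₁) ∪ (Y ∩ Set.range f₂) = Y := by
    rw [← Set.inter_union_distrib_left, Set.inter_eq_left]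
    exact fun x _ => h.union x
  rw [← delta_image f₁, ← delta_image f₂, ← delta_image f₂, e1, e2, e3]
  have hY1 := hY.inter_of_left (Set.range f₁)
  have hY2 := hY.inter_of_left (Set.range f₂)
  have h1 := Set.ncard_union_add_ncard_inter _ _ hY1 hY2
  have h2 := Set.ncard_union_add_ncard_inter _ _ (relSet_finite (n := n) hY1)
    (relSet_finite (n := n) hY2)
  have h3 : relSet n (Y ∩ Set.range f₁) ∪ relSet n (Y ∩ Set.range f₂) = relSet n Y := by
    ext t
    constructor
    · rintro (⟨ht, hY⟩ | ⟨ht, hY⟩)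
      · exact ⟨ht, fun i => (hY i).1⟩
      · exact ⟨ht, fun i => (hY i).1⟩
    · rintro ⟨ht, hY⟩
      rcases h.rel t ht with h | h
      · exact Or.inl ⟨ht, fun i => ⟨hY i, h i⟩⟩
      · exact Or.inr ⟨ht, fun i => ⟨hY i, h i⟩⟩
  have h4 : relSet n (Y ∩ Set.range f₁) ∩ relSet n (Y ∩ Set.range f₂) =
      relSet n ((Y ∩ Set.range f₁) ∩ (Y ∩ Set.range f₂)) := by
    ext t
    constructor
    · rintro ⟨⟨h, a⟩, -, b⟩
      exact ⟨h, fun i => ⟨a i, b i⟩⟩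
    · rintro ⟨h, a⟩
      exact ⟨⟨h, fun i => (a i).1⟩, h, fun i => (a i).2⟩
  rw [e4] at h1
  rw [h3, h4] at h2
  unfold delta
  omega

theorem inCbar (h : IsFreeAmalgam g₁ g₂ f₁ f₂) (h1 : InCbar n A₁)
    (h2 : SelfSufficient n (Set.range g₂)) : InCbar n P := by
  intro Y hY
  have e1 := h.delta_eq hY
  have e2 := h1 _ (hY.preimage f₁.injective.injOn)
  have e3 := h2.delta_inter_le (hY.preimage f₂.injective.injOn)
  omega

theorem selfSufficient_left [Finite A₁] (h : IsFreeAmalgam g₁ g₂ f₁ f₂)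
    (h2 : SelfSufficient n (Set.range g₂)) : SelfSufficient n (Set.range f₁) := by
  refine ⟨Set.finite_range f₁, fun Y hY hfY => ?_⟩
  have e1 := h.delta_eq hY
  have e3 := h2.delta_inter_le (hY.preimage f₂.injective.injOn)
  rw [← Set.image_univ, delta_image]
  rw [Set.range_subset_iff] at hfY
  rw [show f₁ ⁻¹' Y = Set.univ from Set.eq_univ_of_forall hfY] at e1
  omega

end IsFreeAmalgam

/-- The free amalgam is realized on `A₁` together with the points of `A₂` outside `A₀`. -/
theorem exists_isFreeAmalgam (g₁ : A₀ ↪[Ln n] A₁) (g₂ : A₀ ↪[Ln n] A₂) :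
    ∃ (P : Type w) (_ : (Ln n).Structure P) (f₁ : A₁ ↪[Ln n] P) (f₂ : A₂ ↪[Ln n] P),
      IsFreeAmalgam g₁ g₂ f₁ f₂ := by
  classical
  let P := A₁ ⊕ {a : A₂ // a ∉ Set.range g₂}
  let f : A₂ → P := fun a =>
    if h : a ∈ Set.range g₂ then Sum.inl (g₁ h.choose) else Sum.inr ⟨a, h⟩
  have hf1 : ∀ x, f (g₂ x) = Sum.inl (g₁ x) := by
    intro x
    have h : g₂ x ∈ Set.range g₂ := ⟨x, rfl⟩
    have e : h.choose = x := g₂.injective h.choose_spec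
    simp only [f, dif_pos h, e]
  have hf2 : ∀ a (h : a ∉ Set.range g₂), f a = Sum.inr ⟨a, h⟩ := fun a h => dif_neg h
  have hf3 : ∀ a b, (Sum.inl a : P) = f b → ∃ c, g₁ c = a ∧ g₂ c = b := by
    intro a b e
    by_cases h : b ∈ Set.range g₂
    · obtain ⟨c, rfl⟩ := h
      rw [hf1] at e
      exact ⟨c, (Sum.inl.inj e).symm, rfl⟩
    · rw [hf2 b h] at e
      cases e
  have hf4 : Function.Injective f := by
    intro a b e
    by_cases h : a ∈ Set.range g₂
    · obtain ⟨c, rfl⟩ := h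
      rw [hf1] at e
      obtain ⟨c', h1, h2⟩ := hf3 _ _ e
      rw [← h2, g₁.injective h1]
    · by_cases h' : b ∈ Set.range g₂
      · obtain ⟨c, rfl⟩ := h'
        rw [hf1] at e
        obtain ⟨c', h1, h2⟩ := hf3 _ _ e.symm
        rw [← h2, g₁.injective h1]
      · rw [hf2 a h, hf2 b h'] at e
        exact congrArg Subtype.val (Sum.inr.inj e)
  have hpull : ∀ (u : Fin n → A₁) (v : Fin n → A₂), Sum.inl ∘ u = f ∘ v →
      (FirstOrder.Language.Structure.RelMap (Rn n) u ↔
        FirstOrder.Language.Structure.RelMap (Rn n) v) := by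
    intro u v e
    choose x hx1 hx2 using fun i => hf3 (u i) (v i) (congrFun e i)
    rw [← show g₁ ∘ x = u from funext hx1, ← show g₂ ∘ x = v from funext hx2, g₁.map_rel,
      g₂.map_rel]
  let sP : (Ln n).Structure P := structureOfRel fun t =>
    (∃ u : Fin n → A₁, FirstOrder.Language.Structure.RelMap (Rn n) u ∧ Sum.inl ∘ u = t) ∨
    ∃ u : Fin n → A₂, FirstOrder.Language.Structure.RelMap (Rn n) u ∧ f ∘ u = t
  refine ⟨P, sP, embeddingOfRel Sum.inl Sum.inl_injective ?_, embeddingOfRel f hf4 ?_, ?_⟩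
  · refine fun t => ⟨?_, fun h => Or.inl ⟨t, h, rfl⟩⟩
    rintro (⟨u, hu, e⟩ | ⟨u, hu, e⟩)
    · rwa [← Sum.inl_injective.comp_left e]
    · exact (hpull _ _ e.symm).2 hu
  · refine fun t => ⟨?_, fun h => Or.inr ⟨t, h, rfl⟩⟩
    rintro (⟨u, hu, e⟩ | ⟨u, hu, e⟩)
    · exact (hpull _ _ e).1 hu
    · rwa [← hf4.comp_left e]
  · refine ⟨fun a => (hf1 a).symm, ?_, hf3, ?_⟩
    · rintro (a | ⟨a, h⟩)
      · exact Or.inl ⟨a, rfl⟩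
      · exact Or.inr ⟨a, hf2 a h⟩
    · rintro _ (⟨u, -, rfl⟩ | ⟨u, -, rfl⟩)
      · exact Or.inl fun i => ⟨u i, rfl⟩
      · exact Or.inr fun i => ⟨u i, rfl⟩

end FreeAmalgam

/-! ### The class of finite structures with non-negative predimension -/

section ClassC

open StrongClass FirstOrder.Language

variable {n : ℕ}

theorem coe_range {L : FirstOrder.Language.{u, v}} {A B : Type w} [L.Structure A] [L.Structure B]
    (f : A ↪[L] B) : (f.toHom.range : Set B) = Set.range f := by
  ext x
  simp [Hom.mem_range]

theorem strongEmb_classC_iff {A B : Type w} [(Ln n).Structure A] [(Ln n).Structure B]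
    {f : A ↪[Ln n] B} :
    (classC n).StrongEmb f ↔ (Finite B ∧ InCbar n B) ∧ SelfSufficient n (Set.range f) := by
  rw [← coe_range f]
  rfl

/-- Self-sufficiency inside a finite substructure, expressed in the ambient structure. -/
theorem strongIn_classC_iff {M : Type w} [(Ln n).Structure M] {S T : (Ln n).Substructure M} :
    (classC n).StrongIn S T ↔ S ≤ T ∧ Finite T ∧ InCbar n T ∧
      ∀ B : Set M, (S : Set M) ⊆ B → B ⊆ T → delta n (S : Set M) ≤ delta n B := by
  have himg : S ≤ T → T.subtype '' (S.comap T.subtype.toHom : Set T) = S := by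
    intro h
    ext x
    constructor
    · rintro ⟨y, hy, rfl⟩
      exact hy
    · intro hx
      exact ⟨⟨x, h hx⟩, hx, rfl⟩
  constructor
  · rintro ⟨h1, ⟨h2, h3⟩, h4⟩
    refine ⟨h1, h2, h3, fun B hSB hBT => ?_⟩
    have e : T.subtype '' (T.subtype ⁻¹' B) = B := by
      rw [Set.image_preimage_eq_inter_range, Set.inter_eq_left]
      exact fun x hx => ⟨⟨x, hBT hx⟩, rfl⟩
    have h5 := h4.2 (T.subtype ⁻¹' B) (Set.toFinite (α := T) _) fun x hx => hSB hx
    rw [← delta_image T.subtype, himg h1, ← delta_image T.subtype, e] at h5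
    exact h5
  · rintro ⟨h1, h2, h3, h4⟩
    refine ⟨h1, ⟨h2, h3⟩, Set.toFinite (α := T) _, fun B _ hSB => ?_⟩
    rw [← delta_image T.subtype, himg h1, ← delta_image T.subtype B]
    refine h4 _ (fun x hx => ⟨⟨x, h1 hx⟩, hSB hx, rfl⟩) ?_
    rintro _ ⟨x, -, rfl⟩
    exact x.2

theorem strongIn_classC_of_selfSufficient {M : Type w} [(Ln n).Structure M] (hM : InCbar n M)
    {S T : (Ln n).Substructure M} (h : S ≤ T) (hT : (T : Set M).Finite)
    (hS : SelfSufficient n (S : Set M)) : (classC n).StrongIn S T :=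
  strongIn_classC_iff.2 ⟨h, hT, hM.of_embedding T.subtype, fun B hSB hBT =>
    hS.2 B (hT.subset hBT) hSB⟩

theorem selfSufficient_of_strongIn {M : Type w} [(Ln n).Structure M]
    {S T : (Ln n).Substructure M} (h : (classC n).StrongIn S T)
    (hT : SelfSufficient n (T : Set M)) : SelfSufficient n (S : Set M) := by
  obtain ⟨h1, h2, h3, h4⟩ := strongIn_classC_iff.1 h
  refine ⟨hT.1.subset h1, fun B hB hSB => ?_⟩
  have h5 := hT.delta_inter_le hB
  exact (h4 _ (Set.subset_inter hSB h1) Set.inter_subset_right).trans h5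

theorem selfSufficient_empty {M : Type w} [(Ln n).Structure M] (hM : InCbar n M) :
    SelfSufficient n (∅ : Set M) := by
  refine ⟨Set.finite_empty, fun B hB _ => (le_trans ?_ (hM B hB))⟩
  have := delta_le_ncard (n := n) (∅ : Set M)
  simpa using this

/-- Every finite structure is isomorphic to one on an initial segment of the natural numbers. -/
theorem exists_countable_representatives (n : ℕ) :
    ∃ T : Set (Bundled.{w} (Ln n).Structure), T.Countable ∧
      ∀ A : Bundled.{w} (Ln n).Structure, Finite A → ∃ B ∈ T, Nonempty (A ≃[Ln n] B) := by
  let r : (Σ k : ℕ, ((Fin n → Fin k) → Prop)) → Bundled.{w} (Ln n).Structure := fun x =>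
    ⟨ULift (Fin x.1), structureOfRel fun t => x.2 fun i => (t i).down⟩
  refine ⟨Set.range r, Set.countable_range r, fun A hA => ?_⟩
  obtain ⟨k, ⟨e⟩⟩ := Finite.exists_equiv_fin A
  refine ⟨r ⟨k, fun t => FirstOrder.Language.Structure.RelMap (Rn n) (e.symm ∘ t)⟩, ⟨_, rfl⟩, ⟨?_⟩⟩
  let sB := (r ⟨k, fun t => FirstOrder.Language.Structure.RelMap (Rn n) (e.symm ∘ t)⟩).str
  refine { toEquiv := e.trans Equiv.ulift.symm, map_fun' := fun f => isEmptyElim f, map_rel' := ?_ }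
  intro _ ρ t
  cases ρ
  have key : FirstOrder.Language.Structure.RelMap (Rn n) (e.symm ∘ (e ∘ t)) ↔
      FirstOrder.Language.Structure.RelMap (Rn n) t := by
    rw [← Function.comp_assoc, e.symm_comp_self, Function.id_comp]
  exact key

theorem classC_isAdmissible (n : ℕ) : (classC.{w} n).IsAdmissible where
  nonempty := by
    refine ⟨⟨PEmpty, structureOfRel fun _ => False⟩, inferInstanceAs (Finite PEmpty), ?_⟩
    intro X hX
    have h : @relSet n PEmpty (structureOfRel fun _ => False) X = ∅ :=
      Set.eq_empty_of_forall_notMem fun t ht => ht.1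
    change 0 ≤ @delta n PEmpty (structureOfRel fun _ => False) X
    unfold delta
    rw [h]
    simp
  finite _ h := h.1
  countable := by
    obtain ⟨T, hT, h⟩ := exists_countable_representatives.{w} n
    exact ⟨T, hT, fun A hA => h A hA.1⟩
  mem_iso A B := by
    rintro ⟨e⟩ ⟨h1, h2⟩
    exact ⟨Finite.of_equiv A e.toEquiv, h2.of_embedding e.symm.toEmbedding⟩
  mem_of_strong B S h := by
    have := h.1.1
    exact ⟨⟨Subtype.finite, h.1.2.of_embedding S.subtype⟩, h.1⟩
  strong_iso B B' e S := by
    rintro ⟨⟨h1, h2⟩, h3⟩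
    have := Finite.of_equiv B e.toEquiv
    refine ⟨⟨this, h2.of_embedding e.symm.toEmbedding⟩, ?_⟩
    refine SelfSufficient.of_image e.symm.toEmbedding ?_
    convert! h3 using 1
    ext x
    simp

theorem classC_emptyStrong (n : ℕ) : (classC.{w} n).EmptyStrong := by
  intro A hA
  refine ⟨hA, ?_⟩
  convert! selfSufficient_empty hA.2
  rw [← Substructure.closure_empty, Substructure.closure_eq_of_isRelational]

theorem classC_isTransitive (n : ℕ) : (classC.{w} n).IsTransitive :=
  fun _ _ _ hST hT => ⟨hT.1, selfSufficient_of_strongIn hST hT.2⟩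

theorem classC_amalgamation (n : ℕ) : (classC.{w} n).Amalgamation := by
  intro A₀ A₁ A₂ g₁ g₂ _ hA₁ hA₂ hg₁ hg₂
  have h1 := (strongEmb_classC_iff.1 hg₁).2
  have h2 := (strongEmb_classC_iff.1 hg₂).2
  obtain ⟨P, sP, f₁, f₂, h⟩ := exists_isFreeAmalgam g₁ g₂
  have := hA₁.1
  have := hA₂.1
  have hP : Finite P ∧ InCbar n P := by
    refine ⟨?_, h.inCbar hA₁.2 h2⟩
    have : (Set.univ : Set P) = Set.range f₁ ∪ Set.range f₂ := by
      ext x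
      simpa using h.union x
    rw [← Set.finite_univ_iff, this]
    exact (Set.finite_range f₁).union (Set.finite_range f₂)
  exact ⟨⟨P, sP⟩, f₁, f₂, hP, strongEmb_classC_iff.2 ⟨hP, h.selfSufficient_left h2⟩,
    strongEmb_classC_iff.2 ⟨hP, h.symm.selfSufficient_left h1⟩, h.comm⟩

/-- A countable structure is exhausted by a chain of finite self-sufficient substructures. -/
theorem exists_selfSufficient_chain {M : Type w} [(Ln n).Structure M] [Countable M]
    (hM : InCbar n M) : ∃ c : ℕ → (Ln n).Substructure M,
      (∀ i, SelfSufficient n (c i : Set M)) ∧ Monotone c ∧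
      ∀ X : Set M, X.Finite → ∃ i, X ⊆ (c i : Set M) := by
  obtain ⟨e, he⟩ := Countable.exists_injective_nat M
  have step : ∀ (k : ℕ) (S : (Ln n).Substructure M), ∃ T : (Ln n).Substructure M,
      SelfSufficient n (S : Set M) → SelfSufficient n (T : Set M) ∧ S ≤ T ∧ ∀ x, e x = k → x ∈ T := by
    intro k S
    by_cases hS : SelfSufficient n (S : Set M)
    · have hf : (S ∪ e ⁻¹' {k} : Set M).Finite :=
        hS.1.union ((Set.finite_singleton k).preimage he.injOn)
      obtain ⟨B, hB, hBs⟩ := exists_selfSufficient hM hf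
      refine ⟨Substructure.closure (Ln n) B, fun _ => ?_⟩
      rw [Substructure.closure_eq_of_isRelational]
      refine ⟨hBs, fun x hx => ?_, fun x hx => ?_⟩
      · exact Substructure.subset_closure (hB (Or.inl hx))
      · exact Substructure.subset_closure (hB (Or.inr hx))
    · exact ⟨S, fun h => absurd h hS⟩
  choose T hT using step
  obtain ⟨c, hc0, hcs⟩ : ∃ c : ℕ → (Ln n).Substructure M, c 0 = ⊥ ∧ ∀ i, c (i + 1) = T i (c i) :=
    ⟨fun i => Nat.rec ⊥ T i, rfl, fun _ => rfl⟩
  have hc : ∀ i, SelfSufficient n (c i : Set M) := by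
    intro i
    induction i with
    | zero =>
      rw [hc0, ← Substructure.closure_empty, Substructure.closure_eq_of_isRelational]
      exact selfSufficient_empty hM
    | succ i ih => exact hcs i ▸ (hT i (c i) ih).1
  have hmono : Monotone c := monotone_nat_of_le_succ fun i =>
    hcs i ▸ (hT i (c i) (hc i)).2.1
  refine ⟨c, hc, hmono, fun X hX => ?_⟩
  obtain ⟨m, hm⟩ := (hX.image e).bddAbove
  refine ⟨m + 1, fun x hx => ?_⟩
  have h := (hT (e x) (c (e x)) (hc _)).2.2 x rfl
  exact hmono (Nat.succ_le_succ (hm ⟨x, hx, rfl⟩)) (hcs (e x) ▸ h)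

theorem IsGenericC.isGenericChain {M : Type w} [(Ln n).Structure M]
    (h : IsGenericC n ⟨M, inferInstance⟩) {c : ℕ → (Ln n).Substructure M}
    (hc : ∀ i, SelfSufficient n (c i : Set M)) (hmono : Monotone c)
    (hcov : ∀ X : Set M, X.Finite → ∃ i, X ⊆ (c i : Set M)) : (classC n).IsGenericChain c where
  strong i := strongIn_classC_of_selfSufficient h.inCbar (hmono (Nat.le_succ i)) (hc _).1 (hc i)
  union x := by
    obtain ⟨i, hi⟩ := hcov {x} (Set.finite_singleton x)
    exact ⟨i, hi rfl⟩
  extension i A hA B g hB hg := by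
    obtain ⟨f, hf, hfs⟩ := h.extension A (selfSufficient_of_strongIn hA (hc i)) B g hB hg
    obtain ⟨j, hj⟩ := hcov _ hfs.1
    exact ⟨j, f, hf, strongIn_classC_of_selfSufficient h.inCbar hj (hc j).1 hfs⟩

theorem IsGenericC.isGeneric {M : Bundled.{w} (Ln n).Structure} (h : IsGenericC n M) :
    (classC n).IsGeneric M := by
  have := h.countable
  obtain ⟨c, hc, hmono, hcov⟩ := exists_selfSufficient_chain (M := M) h.inCbar
  exact IsGenericChain.isGeneric (classC_isAdmissible n) (h.isGenericChain hc hmono hcov)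

/-- In a generic model, distinguished substructures of members of the chain are self-sufficient in the
whole, since any finite set lies in some member of the chain. -/
theorem isGenericC_of_isGeneric {M : Bundled.{w} (Ln n).Structure} (h : (classC n).IsGeneric M) :
    IsGenericC n M := by
  obtain ⟨c, hc⟩ := h.exists_chain
  have hK := classC_isAdmissible.{w} n
  have hT := classC_isTransitive.{w} n
  have hmono := chain_mono hc.strong
  have hcov : ∀ X : Set M, X.Finite → ∃ i, X ⊆ (c i : Set M) := by
    intro X hX
    choose i hi using hc.union
    obtain ⟨m, hm⟩ := (hX.image i).bddAbove
    exact ⟨m, fun x hx => hmono (hm ⟨x, hx, rfl⟩) (hi x)⟩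
  have hcbar : InCbar n M := by
    intro X hX
    obtain ⟨i, hi⟩ := hcov X hX
    have h1 := (strongIn_classC_iff.1 (hc.strong i))
    have e : (c i).subtype '' ((c i).subtype ⁻¹' X) = X := by
      rw [Set.image_preimage_eq_inter_range, Set.inter_eq_left]
      exact fun x hx => ⟨⟨x, hi hx⟩, rfl⟩
    rw [← e, delta_image]
    have h2 := (StrongEmb.mem_left hK (strongIn_iff.1 (hc.strong i)).2).2
    exact h2 _ (hX.preimage (c i).subtype.injective.injOn)
  -- Each member of the chain is self-sufficient in the union.
  have hself : ∀ (i : ℕ) (A : (Ln n).Substructure M), (classC n).StrongIn A (c i) →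
      SelfSufficient n (A : Set M) := by
    intro i A hA
    have hfin : (c i : Set M).Finite := (strongIn_classC_iff.1 hA).2.1
    refine ⟨hfin.subset hA.1, fun B hB hAB => ?_⟩
    obtain ⟨j, hj⟩ := hcov B hB
    have hA' := hA.chain_of_le hK hT hc.strong (le_max_left i j)
    exact (strongIn_classC_iff.1 hA').2.2.2 B hAB (hj.trans (hmono (le_max_right i j)))
  refine ⟨h.1, hcbar, fun A hA B g hB hg => ?_⟩
  obtain ⟨i, hi⟩ := hcov _ hA.1
  have hfin : (c i : Set M).Finite := (strongIn_classC_iff.1 (hc.strong i)).2.1 |> fun h =>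
    Set.Finite.subset h (chain_mono hc.strong (Nat.le_succ i))
  obtain ⟨j, f, hf, hfs⟩ :=
    hc.extension i A (strongIn_classC_of_selfSufficient hcbar hi hfin hA) B g hB hg
  exact ⟨f, hf, hself j _ hfs⟩

end ClassC

/-! ### Pregeometries represented by relational structures -/

section Represents

open StrongClass FirstOrder.Language

variable {n : ℕ} {A B : Type w}

/-- The `LPI`-structure `p` is the pregeometry `PG` of the `L_n`-structure `s` on the same set. -/
def Represents (n : ℕ) (p : LPI.Structure B) (s : (Ln n).Structure B) : Prop :=
  ∃ h : @InCbar n B s, (@PG n B s h).lpi = p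

theorem represents_PG (s : (Ln n).Structure B) (h : @InCbar n B s) :
    Represents n (@PG n B s h).lpi s :=
  ⟨h, rfl⟩

theorem represents_iff {p : LPI.Structure B} {s : (Ln n).Structure B} (h : @InCbar n B s) :
    Represents n p s ↔ ∀ (k : ℕ) (a : Fin (k + 1) → B),
      p.RelMap (LPIRel.I k) a ↔ (@PG n B s h).Indep a := by
  constructor
  · rintro ⟨_, rfl⟩ k a
    exact Iff.rfl
  · intro hp
    refine ⟨h, ?_⟩
    refine FirstOrder.Language.Structure.ext ?_ ?_
    · funext _ f
      exact Empty.elim f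
    · funext _ r a
      cases r
      exact propext (hp _ a).symm

/-- If `A` and `B` are represented by `sA` and `sB`, an embedding of pregeometries is an injection
preserving dimensions. -/
theorem Represents.dim_image {p : LPI.Structure A} {q : LPI.Structure B} {sA : (Ln n).Structure A}
    {sB : (Ln n).Structure B} (hA : Represents n p sA) (hB : Represents n q sB) (f : A ↪[LPI] B)
    {X : Set A} (hX : X.Finite) : @dim n B sB (f '' X) = @dim n A sA X := by
  refine dim_image_of_indep_iff hA.1 hB.1 f.injective (fun k a => ?_) hX
  rw [← (represents_iff hA.1).1 hA k a, ← (represents_iff hB.1).1 hB k (f ∘ a)]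
  exact (f.map_rel (LPIRel.I k) a).symm

/-- A self-sufficient embedding of relational structures is an embedding of pregeometries. -/
theorem Represents.exists_embedding {p : LPI.Structure A} {q : LPI.Structure B}
    {sA : (Ln n).Structure A} {sB : (Ln n).Structure B} (hA : Represents n p sA)
    (hB : Represents n q sB) (f : A ↪[Ln n] B) (hf : SelfSufficient n (Set.range f)) :
    ∃ g : A ↪[LPI] B, ∀ a, g a = f a := by
  refine ⟨⟨⟨f, f.injective⟩, fun g => isEmptyElim g, fun {k} r a => ?_⟩, fun _ => rfl⟩
  cases r with
  | I k =>
    refine ((represents_iff hB.1).1 hB k (f ∘ a)).trans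
      (Iff.trans ?_ ((represents_iff hA.1).1 hA k a).symm)
    exact (indep_comp_iff_of_dim_image hA.1 hB.1 f.injective
      (fun X hX => hf.dim_image hA.1 hB.1 hX) a).symm

/-- Two structures with the same dimension function represent the same pregeometry. -/
theorem Represents.congr_dim {p : LPI.Structure B} {s s' : (Ln n).Structure B}
    (h : Represents n p s) (h' : @InCbar n B s')
    (hd : ∀ X : Set B, X.Finite → @dim n B s' X = @dim n B s X) : Represents n p s' := by
  refine (represents_iff h').2 fun k a => ((represents_iff h.1).1 h k a).trans ?_
  rw [@indep_iff n B s h.1, @indep_iff n B s' h', hd _ (Set.finite_range a)]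

/-- The structure induced on the domain of an injection. -/
@[reducible]
def pullback (f : A → B) (s : (Ln n).Structure B) : (Ln n).Structure A :=
  structureOfRel fun t => s.RelMap (Rn n) (f ∘ t)

theorem Represents.pullback {p : LPI.Structure A} {q : LPI.Structure B} {s : (Ln n).Structure B}
    (h : Represents n q s) (f : A ↪[LPI] B) (hf : SelfSufficient n (Set.range f)) :
    Represents n p (pullback f s) := by
  let sA := HrushovskiGeometry.pullback f s
  let f' : A ↪[Ln n] B := embeddingOfRel f f.injective fun t => Iff.rfl
  have hA : InCbar n A := h.1.of_embedding f'
  refine (represents_iff hA).2 fun k a => ?_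
  rw [indep_comp_iff_of_dim_image (f := f') hA h.1 f'.injective
    (fun X hX => SelfSufficient.dim_image (f := f') hA h.1 hf hX) a]
  rw [← (represents_iff h.1).1 h k (f' ∘ a)]
  exact (f.map_rel (LPIRel.I k) a).symm

/-- If a finite subpregeometry `A` of `B` is self-sufficient in a structure representing `B`, then
the structure on `A` may be replaced by any other one which represents the pregeometry `A`:
the result still represents `B`, and `A` is still self-sufficient in it. -/
theorem Represents.exists_change {p : LPI.Structure A} {q : LPI.Structure B}
    {sA : (Ln n).Structure A} {sB : (Ln n).Structure B} (hA : Represents n p sA)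
    (hB : Represents n q sB) (f : A ↪[LPI] B) (hf : SelfSufficient n (Set.range f)) :
    ∃ sB' : (Ln n).Structure B, Represents n q sB' ∧ @SelfSufficient n B sB' (Set.range f) ∧
      ∀ t : Fin n → A, sB'.RelMap (Rn n) (f ∘ t) ↔ sA.RelMap (Rn n) t := by
  let sB' : (Ln n).Structure B := structureOfRel fun t =>
    (sB.RelMap (Rn n) t ∧ ¬ ∀ i, t i ∈ Set.range f) ∨
      ∃ u : Fin n → A, sA.RelMap (Rn n) u ∧ f ∘ u = t
  have hrel : ∀ t : Fin n → A, sB'.RelMap (Rn n) (f ∘ t) ↔ sA.RelMap (Rn n) t := by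
    refine fun t => ⟨?_, fun h => Or.inr ⟨t, h, rfl⟩⟩
    rintro (⟨-, h⟩ | ⟨u, hu, e⟩)
    · exact absurd (fun i => ⟨t i, rfl⟩) h
    · rwa [← f.injective.comp_left e]
  have hag : ∀ t : Fin n → B, (¬ ∀ i, t i ∈ Set.range f) →
      (sB.RelMap (Rn n) t ↔ sB'.RelMap (Rn n) t) := by
    refine fun t ht => ⟨fun h => Or.inl ⟨h, ht⟩, ?_⟩
    rintro (⟨h, -⟩ | ⟨u, -, rfl⟩)
    · exact h
    · exact absurd (fun i => ⟨u i, rfl⟩) ht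
  let f' := @embeddingOfRel n A B sA sB' f f.injective hrel
  have hδ : ∀ X : Set A, @delta n B sB' (f '' X) = @delta n A sA X := fun X =>
    @delta_image n A B sA sB' f' X
  have hfin : ∀ X ⊆ Set.range f, ∃ Y : Set A, Y.Finite ∧ f '' Y = X := by
    intro X hX
    have e : f '' (f ⁻¹' X) = X := by
      rw [Set.image_preimage_eq_inter_range, Set.inter_eq_left]
      exact hX
    exact ⟨f ⁻¹' X, (hf.1.subset hX).preimage f.injective.injOn, e⟩
  have hself := selfSufficient_of_change hag hf
  have hbar : @InCbar n B sB' := by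
    refine inCbar_of_change hag hf fun X hX => ?_
    obtain ⟨Y, hY, rfl⟩ := hfin X hX
    rw [hδ]
    exact hA.1 Y hY
  -- The structure on the range of `f` has the same dimension function before and after.
  let sA' := HrushovskiGeometry.pullback f sB
  have hA' : Represents n p sA' := hB.pullback f hf
  have hδ' : ∀ X : Set A, @delta n B sB (f '' X) = @delta n A sA' X := fun X =>
    @delta_image n A B sA' sB
      (@embeddingOfRel n A B sA' sB f f.injective fun _ => Iff.rfl) X
  have hdimA : ∀ X : Set A, X.Finite → @dim n A sA X = @dim n A sA' X := by
    intro X hX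
    have := hA.dim_image hA' (@Embedding.refl LPI A p) hX
    rw [show ⇑(@Embedding.refl LPI A p) = id from rfl, Set.image_id] at this
    exact this.symm
  refine ⟨sB', hB.congr_dim hbar fun X hX => le_antisymm ?_ ?_, hself, hrel⟩
  · refine dim_le_of_change hag hf.1 hB.1 hbar (fun X hX => ?_) hX
    obtain ⟨Y, hY, rfl⟩ := hfin X hX
    obtain ⟨Z, hZ, hYZ, e⟩ := @dim_attained n A sA hA.1 Y hY
    refine ⟨f '' Z, Set.image_mono hYZ, Set.image_subset_range f Z, ?_⟩
    rw [hδ, hδ', e, hdimA Y hY]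
    exact @dim_le n A sA' hA'.1 Y Y hY subset_rfl
  · refine dim_le_of_change (fun t ht => (hag t ht).symm) hf.1 hbar hB.1 (fun X hX => ?_) hX
    obtain ⟨Y, hY, rfl⟩ := hfin X hX
    obtain ⟨Z, hZ, hYZ, e⟩ := @dim_attained n A sA' hA'.1 Y hY
    refine ⟨f '' Z, Set.image_mono hYZ, Set.image_subset_range f Z, ?_⟩
    rw [hδ, hδ', e, ← hdimA Y hY]
    exact @dim_le n A sA hA.1 Y Y hY subset_rfl

end Represents

/-! ### The class of finite pregeometries -/

section ClassP

open StrongClass FirstOrder.Language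

variable {n : ℕ}

/-- In the definition of `A ⊴ B` the structure on `A` is determined by the one on `B`. -/
theorem pStrong_iff {B : Bundled.{w} LPI.Structure} {A : LPI.Substructure B} :
    PStrong n B A ↔ Finite B ∧ ∃ s : (Ln n).Structure B, Represents n B.str s ∧
      @SelfSufficient n B s (A : Set B) := by
  constructor
  · rintro ⟨_, sB, _, hB, hfin, _, hrep, _, hs⟩
    exact ⟨hfin, sB, ⟨hB, hrep⟩, hs⟩
  · rintro ⟨hfin, s, hrep, hs⟩
    have hr : Set.range A.subtype = (A : Set B) := Subtype.range_coe
    have hA : Represents n inferInstance (HrushovskiGeometry.pullback A.subtype s) :=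
      hrep.pullback A.subtype (by rwa [hr])
    exact ⟨_, s, hA.1, hrep.1, hfin, hA.2, hrep.2, fun _ => Iff.rfl, hs⟩

theorem mem_classP_iff {A : Bundled.{w} LPI.Structure} :
    (classP n).mem A ↔ Finite A ∧ ∃ s : (Ln n).Structure A, Represents n A.str s := by
  refine pStrong_iff.trans (and_congr_right fun _ => exists_congr fun s => ?_)
  refine and_iff_left_of_imp fun h => ?_
  rw [← Substructure.closure_empty, Substructure.closure_eq_of_isRelational]
  exact selfSufficient_empty h.1

theorem strongEmb_classP_iff {A B : Type w} [LPI.Structure A] [q : LPI.Structure B]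
    {f : A ↪[LPI] B} : (classP n).StrongEmb f ↔ Finite B ∧ ∃ s : (Ln n).Structure B,
      Represents n q s ∧ @SelfSufficient n B s (Set.range f) := by
  rw [← coe_range f]
  exact pStrong_iff

theorem Represents.of_equiv {A B : Type w} {p : LPI.Structure A} {q : LPI.Structure B}
    {s : (Ln n).Structure A} (h : Represents n p s) (e : B ≃[LPI] A) :
    Represents n q (HrushovskiGeometry.pullback e s) := by
  let sB := HrushovskiGeometry.pullback e s
  let f : B ↪[Ln n] A := embeddingOfRel e e.injective fun t => Iff.rfl
  have hB : InCbar n B := h.1.of_embedding f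
  have hdim : ∀ X : Set B, X.Finite → dim n (f '' X) = dim n X := by
    intro X _
    unfold dim
    congr 1
    ext z
    constructor
    · rintro ⟨Y, hY, hXY, rfl⟩
      refine ⟨f ⁻¹' Y, hY.preimage f.injective.injOn, Set.image_subset_iff.1 hXY, ?_⟩
      rw [← delta_image f, Set.image_preimage_eq Y (f := f) e.surjective]
    · rintro ⟨Y, hY, hXY, rfl⟩
      exact ⟨f '' Y, hY.image f, Set.image_mono hXY, delta_image f Y⟩
  refine (represents_iff hB).2 fun k a => ?_
  rw [indep_comp_iff_of_dim_image hB h.1 f.injective hdim a,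
    ← (represents_iff h.1).1 h k (f ∘ a)]
  exact (e.map_rel (LPIRel.I k) a).symm

theorem nonempty_equiv_of_surjective {L : FirstOrder.Language.{u, v}} {A B : Type w}
    [L.Structure A] [L.Structure B] (f : A ↪[L] B) (hf : Function.Surjective f) :
    Nonempty (A ≃[L] B) :=
  ⟨⟨_root_.Equiv.ofBijective f ⟨f.injective, hf⟩, f.map_fun, f.map_rel⟩⟩

theorem classP_isAdmissible (n : ℕ) : (classP.{w} n).IsAdmissible where
  nonempty := by
    obtain ⟨A, hA⟩ := (classC_isAdmissible.{w} n).nonempty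
    exact ⟨PGStr n A hA.2, mem_classP_iff.2 ⟨hA.1, A.str, represents_PG _ hA.2⟩⟩
  finite _ h := (mem_classP_iff.1 h).1
  countable := by
    obtain ⟨T, hT, h⟩ := (classC_isAdmissible.{w} n).countable
    have hT' : (T ∩ {B | InCbar n B}).Countable := hT.mono Set.inter_subset_left
    have := hT'.to_subtype
    refine ⟨Set.range fun B : ↥(T ∩ {B | InCbar n B}) => PGStr n B.1 B.2.2,
      Set.countable_range _, fun A hA => ?_⟩
    obtain ⟨hfin, s, hs⟩ := mem_classP_iff.1 hA
    obtain ⟨B, hB, ⟨e⟩⟩ := h ⟨A, s⟩ ⟨hfin, hs.1⟩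
    let e' : B ≃[Ln n] (⟨A, s⟩ : Bundled.{w} (Ln n).Structure) := e.symm
    have hBc : InCbar n B := InCbar.of_embedding hs.1 e'.toEmbedding
    refine ⟨_, ⟨⟨B, hB, hBc⟩, rfl⟩, ?_⟩
    have hr : SelfSufficient n (Set.range e.toEmbedding) := by
      have : Finite B := Finite.of_equiv A e.toEquiv
      refine ⟨Set.toFinite _, fun Y _ hY => ?_⟩
      rw [Set.Subset.antisymm hY fun y _ => e.surjective y]
    obtain ⟨g, hg⟩ := hs.exists_embedding (represents_PG B.str hBc) e.toEmbedding hr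
    exact nonempty_equiv_of_surjective g fun b => (e.surjective b).imp fun a ha => (hg a).trans ha
  mem_iso A B := by
    rintro ⟨e⟩ hA
    obtain ⟨hfin, s, hs⟩ := mem_classP_iff.1 hA
    exact mem_classP_iff.2 ⟨Finite.of_equiv A e.toEquiv, _, hs.of_equiv e.symm⟩
  mem_of_strong B S h := by
    obtain ⟨hfin, s, hs, hS⟩ := pStrong_iff.1 h
    have hr : Set.range S.subtype = (S : Set B) := Subtype.range_coe
    exact ⟨mem_classP_iff.2 ⟨Subtype.finite, _, hs.pullback S.subtype (by rwa [hr])⟩,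
      mem_classP_iff.2 ⟨hfin, s, hs⟩⟩
  strong_iso B B' e S h := by
    obtain ⟨hfin, s, hs, hS⟩ := pStrong_iff.1 h
    refine pStrong_iff.2 ⟨Finite.of_equiv B e.toEquiv, _, hs.of_equiv e.symm, ?_⟩
    let s' := HrushovskiGeometry.pullback e.symm s
    let f : B' ↪[Ln n] B := embeddingOfRel e.symm e.symm.injective fun t => Iff.rfl
    refine SelfSufficient.of_image f ?_
    convert! hS using 1
    ext x
    constructor
    · rintro ⟨_, ⟨a, ha, rfl⟩, rfl⟩
      exact (e.symm_apply_apply a).symm ▸ ha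
    · exact fun hx => ⟨e x, ⟨x, hx, rfl⟩, e.symm_apply_apply x⟩

theorem classP_emptyStrong (n : ℕ) : (classP.{w} n).EmptyStrong := fun _ h => h

/-- If `S ⊴ T ⊴ C`, the structure witnessing `S ⊴ T` is put on `T` inside the one witnessing
`T ⊴ C`; then `S` is self-sufficient in the resulting structure on `C`. -/
theorem classP_isTransitive (n : ℕ) : (classP.{w} n).IsTransitive := by
  intro C S T hST hT
  obtain ⟨hfin, s, hs, hTs⟩ := pStrong_iff.1 hT
  obtain ⟨hle, h⟩ := hST
  obtain ⟨-, sT, hsT, hS⟩ := pStrong_iff.1 h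
  have hr : Set.range T.subtype = (T : Set C) := Subtype.range_coe
  obtain ⟨s', hs', hT', hrel⟩ := hsT.exists_change hs T.subtype (by rwa [hr])
  refine pStrong_iff.2 ⟨hfin, s', hs', ?_⟩
  let f : T ↪[Ln n] C := embeddingOfRel T.subtype T.subtype.injective hrel
  have := SelfSufficient.image (f := f) hT' hS
  convert! this using 1
  ext x
  constructor
  · intro hx
    exact ⟨⟨x, hle hx⟩, hx, rfl⟩
  · rintro ⟨y, hy, rfl⟩
    exact hy

theorem classP_amalgamation (n : ℕ) : (classP.{w} n).Amalgamation := by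
  intro A₀ A₁ A₂ g₁ g₂ hA₀ hA₁ hA₂ hg₁ hg₂
  obtain ⟨fin₁, s₁, hs₁, h₁⟩ := strongEmb_classP_iff.1 hg₁
  obtain ⟨fin₂, s₂, hs₂, h₂⟩ := strongEmb_classP_iff.1 hg₂
  -- Change the structure on `A₂` so that both structures induce the same one on `A₀`.
  let s₀ := HrushovskiGeometry.pullback g₁ s₁
  have hs₀ : Represents n A₀.str s₀ := hs₁.pullback g₁ h₁
  obtain ⟨s₂', hs₂', h₂', hrel⟩ := hs₀.exists_change hs₂ g₂ h₂
  let e₁ : A₀ ↪[Ln n] A₁ := embeddingOfRel g₁ g₁.injective fun _ => Iff.rfl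
  let e₂ := @embeddingOfRel n A₀ A₂ s₀ s₂' g₂ g₂.injective hrel
  obtain ⟨P, f₁, f₂, -, hf₁, hf₂, hcomm⟩ := classC_amalgamation n ⟨A₀, s₀⟩ ⟨A₁, s₁⟩ ⟨A₂, s₂'⟩ e₁ e₂
    ⟨(mem_classP_iff.1 hA₀).1, hs₀.1⟩ ⟨fin₁, hs₁.1⟩ ⟨fin₂, hs₂'.1⟩
    (strongEmb_classC_iff.2 ⟨⟨fin₁, hs₁.1⟩, h₁⟩)
    ((@strongEmb_classC_iff n A₀ A₂ s₀ s₂' e₂).2 ⟨⟨fin₂, hs₂'.1⟩, h₂'⟩)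
  obtain ⟨⟨finP, hP⟩, hf₁⟩ := strongEmb_classC_iff.1 hf₁
  obtain ⟨-, hf₂⟩ := (@strongEmb_classC_iff n A₂ P s₂' P.str f₂).1 hf₂
  let pP : LPI.Structure P := (PG n P hP).lpi
  have hPr : Represents n pP P.str := represents_PG P.str hP
  obtain ⟨k₁, hk₁⟩ := hs₁.exists_embedding hPr f₁ hf₁
  obtain ⟨k₂, hk₂⟩ := hs₂'.exists_embedding hPr f₂ hf₂
  refine ⟨⟨P, pP⟩, k₁, k₂, mem_classP_iff.2 ⟨finP, P.str, hPr⟩,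
    strongEmb_classP_iff.2 ⟨finP, P.str, hPr, ?_⟩,
    strongEmb_classP_iff.2 ⟨finP, P.str, hPr, ?_⟩, fun a => ?_⟩
  · rwa [show Set.range k₁ = Set.range f₁ from congrArg Set.range (funext hk₁)]
  · rwa [show Set.range k₂ = Set.range f₂ from congrArg Set.range (funext hk₂)]
  · exact (hk₁ _).trans ((hcomm a).trans (hk₂ _).symm)

end ClassP

/-! ### The pregeometry of the generic structure -/

section GenericPregeometry

open StrongClass FirstOrder.Language

variable {n : ℕ} {M : Type w}

theorem strongIn_classP_of_selfSufficient {p : LPI.Structure M} {s : (Ln n).Structure M}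
    (hs : Represents n p s) {S T : LPI.Substructure M} (h : S ≤ T)
    (hS : SelfSufficient n (S : Set M)) (hT : SelfSufficient n (T : Set M)) :
    (classP n).StrongIn S T := by
  have hr : Set.range T.subtype = (T : Set M) := Subtype.range_coe
  have hrep : Represents n inferInstance (HrushovskiGeometry.pullback T.subtype s) :=
    hs.pullback T.subtype (by rwa [hr])
  refine ⟨h, pStrong_iff.2 ⟨hT.1, _, hrep, ?_⟩⟩
  let sT := HrushovskiGeometry.pullback T.subtype s
  let f : T ↪[Ln n] M := embeddingOfRel T.subtype T.subtype.injective fun _ => Iff.rfl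
  refine SelfSufficient.of_image f ?_
  convert! hS using 1
  ext x
  constructor
  · rintro ⟨y, hy, rfl⟩
    exact hy
  · intro hx
    exact ⟨⟨x, h hx⟩, hx, rfl⟩

/-- To realize an extension `B` of `A ⊴ cᵢ` inside the pregeometry of the generic structure, `B` is
amalgamated with `cᵢ` as pregeometries; the amalgam is then represented by a relational structure
extending the given one on `cᵢ`, and this embeds in the generic structure over `cᵢ`. -/
theorem IsGenericC.isGeneric_PGStr {M : Bundled.{w} (Ln n).Structure} (hM : IsGenericC n M) :
    (classP n).IsGeneric (PGStr n M hM.inCbar) := by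
  have hK := classP_isAdmissible.{w} n
  have hT := classP_isTransitive.{w} n
  have := hM.countable
  let p : LPI.Structure M := (PG n M hM.inCbar).lpi
  have hp : Represents n p M.str := represents_PG M.str hM.inCbar
  obtain ⟨c, hc, hmono, hcov⟩ := exists_selfSufficient_chain (M := M) hM.inCbar
  let d : ℕ → LPI.Substructure M := fun i => ⟨c i, fun f => isEmptyElim f⟩
  refine IsGenericChain.isGeneric (M := M) (c := d) hK ⟨fun i => ?_, fun x => ?_, ?_⟩
  · exact strongIn_classP_of_selfSufficient hp (hmono (Nat.le_succ i)) (hc _) (hc _)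
  · obtain ⟨i, hi⟩ := hcov {x} (Set.finite_singleton x)
    exact ⟨i, hi rfl⟩
  intro i A hA B g hB hg
  obtain ⟨hle, hAd⟩ := strongIn_iff.1 hA
  obtain ⟨P, pP, f₁, f₂, hf₁, hf₂, hcomm⟩ :=
    (classP_amalgamation n).exists_strongEmb hK (C := B) hAd hg
  obtain ⟨finP, sP, hsP, hf₁s⟩ := strongEmb_classP_iff.1 hf₁
  have hr : Set.range (d i).subtype = (c i : Set M) := Subtype.range_coe
  have hd : Represents n inferInstance (HrushovskiGeometry.pullback (d i).subtype M.str) :=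
    hp.pullback (d i).subtype (by rw [hr]; exact hc i)
  obtain ⟨sP', hsP', hf₁s', hrel⟩ := hd.exists_change hsP f₁ hf₁s
  let g' : c i ↪[Ln n] P := embeddingOfRel (fun x => f₁ ⟨x.1, x.2⟩)
    (fun x y e => Subtype.ext (congrArg Subtype.val (f₁.injective e))) hrel
  have hg' : (classC n).StrongEmb g' := strongEmb_classC_iff.2 ⟨⟨finP, hsP'.1⟩, hf₁s'⟩
  obtain ⟨h, hh, hhs⟩ := hM.extension (c i) (hc i) ⟨P, sP'⟩ g' ⟨finP, hsP'.1⟩ hg'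
  obtain ⟨k, hk⟩ := hsP'.exists_embedding hp h hhs
  obtain ⟨j, hj⟩ := hcov _ hhs.1
  have hkr : (k.toHom.range : Set M) = (h.toHom.range : Set M) := by
    rw [coe_range, coe_range]
    exact congrArg Set.range (funext hk)
  refine ⟨j, k.comp f₂, fun a => ?_, ?_⟩
  · have h1 := hh ⟨a, hle a.2⟩
    have h2 := hcomm a
    exact (congrArg k h2.symm).trans ((hk _).trans h1)
  · have h1 : (classP n).StrongIn (k.comp f₂).toHom.range k.toHom.range :=
      (strongIn_range_iff hK fun _ => rfl).2 hf₂
    refine h1.trans hK hT (strongIn_classP_of_selfSufficient hp ?_ ?_ (hc j))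
    · exact fun x hx => hj (hkr ▸ hx : x ∈ (h.toHom.range : Set M))
    · rw [hkr]
      exact hhs

end GenericPregeometry

end HrushovskiGeometry

theorem theorem6p8 (n : ℕ) (hn : 0 < n) :
    -- general existence and uniqueness of generic models
    (∀ (L : FirstOrder.Language.{u, v}) [L.IsRelational] [IsEmpty (L.Relations 0)]
      [Countable L.Symbols] (K : HrushovskiGeometry.StrongClass.{u, v, w} L),
      K.IsAdmissible → K.EmptyStrong → K.IsTransitive → K.Amalgamation →
        (∃ M : CategoryTheory.Bundled.{w} L.Structure, K.IsGeneric M) ∧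
        ∀ M N : CategoryTheory.Bundled.{w} L.Structure,
          K.IsGeneric M → K.IsGeneric N → Nonempty (M ≃[L] N)) ∧
    -- the class of pregeometries satisfies the hypotheses
    (HrushovskiGeometry.classP.{w} n).IsAdmissible ∧
    (HrushovskiGeometry.classP.{w} n).EmptyStrong ∧
    (HrushovskiGeometry.classP.{w} n).IsTransitive ∧
    (HrushovskiGeometry.classP.{w} n).Amalgamation ∧
    -- existence and uniqueness of its generic model
    (∃ P : CategoryTheory.Bundled.{w} HrushovskiGeometry.LPI.Structure,
      (HrushovskiGeometry.classP n).IsGeneric P) ∧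
    (∀ P Q : CategoryTheory.Bundled.{w} HrushovskiGeometry.LPI.Structure,
      (HrushovskiGeometry.classP n).IsGeneric P → (HrushovskiGeometry.classP n).IsGeneric Q →
        Nonempty (P ≃[HrushovskiGeometry.LPI] Q)) ∧
    -- existence and uniqueness of the generic structure for the class of relational structures
    (∃ M : CategoryTheory.Bundled.{w} (HrushovskiGeometry.Ln n).Structure,
      HrushovskiGeometry.IsGenericC n M) ∧
    (∀ M N : CategoryTheory.Bundled.{w} (HrushovskiGeometry.Ln n).Structure,
      HrushovskiGeometry.IsGenericC n M → HrushovskiGeometry.IsGenericC n N →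
        Nonempty (M ≃[HrushovskiGeometry.Ln n] N)) ∧
    -- the generic model is the pregeometry of the generic structure
    (∀ (P : CategoryTheory.Bundled.{w} HrushovskiGeometry.LPI.Structure)
      (M : CategoryTheory.Bundled.{w} (HrushovskiGeometry.Ln n).Structure),
      (HrushovskiGeometry.classP n).IsGeneric P → ∀ hM : HrushovskiGeometry.IsGenericC n M,
        Nonempty (P ≃[HrushovskiGeometry.LPI] HrushovskiGeometry.PGStr n M hM.inCbar)) := by
  have := HrushovskiGeometry.isEmpty_Ln_relations_zero hn
  have hC := HrushovskiGeometry.classC_isAdmissible.{w} n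
  have hCe := HrushovskiGeometry.classC_emptyStrong.{w} n
  have hCt := HrushovskiGeometry.classC_isTransitive.{w} n
  have hP := HrushovskiGeometry.classP_isAdmissible.{w} n
  have hPe := HrushovskiGeometry.classP_emptyStrong.{w} n
  have hPt := HrushovskiGeometry.classP_isTransitive.{w} n
  have hPa := HrushovskiGeometry.classP_amalgamation.{w} n
  refine ⟨fun L _ _ _ K hK hE hT hA =>
      ⟨HrushovskiGeometry.StrongClass.exists_isGeneric hK hE hT hA,
        fun M N hM hN => hM.nonempty_equiv hK hE hT hN⟩,
    hP, hPe, hPt, hPa, HrushovskiGeometry.StrongClass.exists_isGeneric hP hPe hPt hPa,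
    fun P Q h h' => h.nonempty_equiv hP hPe hPt h', ?_,
    fun M N hM hN => hM.isGeneric.nonempty_equiv hC hCe hCt hN.isGeneric,
    fun P M h hM => h.nonempty_equiv hP hPe hPt hM.isGeneric_PGStr⟩
  obtain ⟨M, hM⟩ := HrushovskiGeometry.StrongClass.exists_isGeneric hC hCe hCt
    (HrushovskiGeometry.classC_amalgamation n)
  exact ⟨M, HrushovskiGeometry.isGenericC_of_isGeneric hM⟩
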